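/- For an integer $d\ge 1$ let $\gamma_d(x)=\sum_{k=0}^{d-1}\frac{x^k}{k!}$. Fix an integer $\Delta\ge 3$. The equation $\frac{x\gamma_{\Delta-1}(x)}{\gamma_\Delta(x)}=1$ has a unique solution $\alpha_\Delta$ in $(1,\infty)$; put $a_\Delta=\gamma_{\Delta-1}(\alpha_\Delta)$. Let $w=w(n)$ be any sequence of real numbers with $0<w(n)\le n$ for all $n\ge 1$. Then, as $n\to\infty$: 1. The number $t_\Delta(n)$ of labelled trees on $[n]=\{1,\dots,n\}$ with maximum degree at most $\Delta$ satisfies $$t_\Delta(n)=(1+o(1))\,\alpha_\Delta\sqrt{\frac{\gamma_\Delta(\alpha_\Delta)}{\gamma_{\Delta-2}(\alpha_\Delta)}}\left(\frac{a_\Delta}{e}\right)^n n^{n-2}.$$ 2. Let $f_\Delta(n,m)$ be the number of labelled rooted forests on $[n]$ (each component has exactly one root) with $m$ components, with maximum degree at most $\Delta$, and with all roots of degree at most $\Delta-1$. For every $n\ge1$ the saddle-point equation $$\frac{x\gamma_\Delta'(x)}{\gamma_\Delta(x)}+\frac{xw}{n}=1$$ has a unique positive solution $r=r(n)$, and $$\sum_{m=1}^n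 f_\Delta(n,m)\,w^m=(1+o(1))\,w\,\frac{(n-1)!}{r^{n-1}}\cdot\frac{(\gamma_\Delta(r))^n e^{rw}}{\sqrt{2\pi\beta(r)n}},\qquad \beta(r)=\frac{r^2\gamma_\Delta''(r)}{\gamma_\Delta(r)}+\frac{2rw}{n}-\frac{r^2w^2}{n^2}.$$ -/

import Mathlib

open Filter Asymptotics

/-- The polynomial `γ_Δ(x) = ∑_{k=0}^{Δ-1} x^k / k!`. -/
noncomputable def gammaPoly (Δ : ℕ) (x : ℝ) : ℝ :=
  ∑ k ∈ Finset.range Δ, x ^ k / (k.factorial : ℝ)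

/-- `α` is a solution in `(1, ∞)` of `x γ_{Δ-1}(x) / γ_Δ(x) = 1`. -/
def IsAlpha (Δ : ℕ) (α : ℝ) : Prop :=
  1 < α ∧ α * gammaPoly (Δ - 1) α / gammaPoly Δ α = 1

open Classical in
/-- The number of labelled trees on `n` vertices with maximum degree at most `Δ`. -/
noncomputable def treeCount (Δ n : ℕ) : ℕ :=
  Nat.card {G : SimpleGraph (Fin n) // G.IsTree ∧ ∀ v, G.degree v ≤ Δ}

open Classical in
/-- `(G, R)` is a rooted forest with root set `R`, with `m` components, all degrees at most `Δ`
and all degrees of roots at most `Δ - 1`. -/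
def IsBoundedRootedForest (Δ m : ℕ) {n : ℕ} (G : SimpleGraph (Fin n)) (R : Finset (Fin n)) :
    Prop :=
  G.IsAcyclic ∧
  (∀ c : G.ConnectedComponent, ∃! v, v ∈ R ∧ G.connectedComponentMk v = c) ∧
  Nat.card G.ConnectedComponent = m ∧
  (∀ v, G.degree v ≤ Δ) ∧
  (∀ v ∈ R, G.degree v ≤ Δ - 1)

/-- The number `f_Δ(n, m)` of labelled rooted forests on `n` vertices with `m` components, all
degrees at most `Δ` and all degrees of roots at most `Δ - 1`. -/
noncomputable def rootedForestCount (Δ n m : ℕ) : ℕ :=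
  Nat.card {F : SimpleGraph (Fin n) × Finset (Fin n) // IsBoundedRootedForest Δ m F.1 F.2}

/-- `r` is a positive solution of the saddle-point equation
`x γ_Δ'(x) / γ_Δ(x) + x w / n = 1`, that is, a positive critical point of
`n log γ_Δ(x) - n log x + w x`. -/
def IsSaddlePoint (Δ n : ℕ) (w r : ℝ) : Prop :=
  0 < r ∧ r * deriv (gammaPoly Δ) r / gammaPoly Δ r + r * w / n = 1

/-- `β(r) = r² γ_Δ''(r) / γ_Δ(r) + 2 r w / n - r² w² / n²`. -/
noncomputable def betaFun (Δ n : ℕ) (w r : ℝ) : ℝ :=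
  r ^ 2 * deriv (deriv (gammaPoly Δ)) r / gammaPoly Δ r + 2 * r * w / n
    - r ^ 2 * w ^ 2 / (n : ℝ) ^ 2

/-!
Both counts reduce to coefficients of powers of `γ_Δ`, and the coefficients are estimated by the
saddle-point method.

*Reduction to coefficients.* The number of trees on a vertex set `V` in which `v` has degree
`e v + 1` is the multinomial coefficient `(|V| - 2)! / ∏ v, (e v)!`
(`connectedCount_mul_prod_factorial`, by removing a leaf and summing over its neighbour). Summing
over `e v < Δ` shows that the number of trees on `n` vertices with degrees at most `Δ` is `(n - 2)!`
times the coefficient of `x ^ (n - 2)` in `γ_Δ(x) ^ n`. A rooted forest becomes a tree when a new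
vertex is joined to all the roots (`coneGraph_isTree_iff`); the new vertex has degree `m`, the
number of components, and the condition on root degrees says that all other degrees in the tree are
at most `Δ`. Hence `∑ m, f_Δ(n, m) w ^ m` is `w (n - 1)!` times the coefficient of `x ^ (n - 1)`
in `γ_Δ(x) ^ n exp (w x)` (`sum_rootedForestCount`).

*Saddle point.* With the denominator cleared, the saddle-point equation equates to one a polynomial
with non-negative coefficients, so its positive root `r` is unique. For `Δ ≥ 3` and `0 ≤ w ≤ n` it
lies in `[1 / 2, 2]`, which makes all later estimates uniform in `w`. Cauchy's formula on the circle
of radius `r` (`integral_tiltCharFun_pow`) expresses the coefficient of `x ^ (n - k)` as an integral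
of `φ ^ n exp (i k t)`, where `φ` (`saddleCharFun`) is the characteristic function of `X + Y - 1`
for independent `X` with weights proportional to `r ^ k / k!`, `k < Δ`, and `Y` Poisson with
parameter `r w / n`. The saddle-point equation says that this variable is centred, and its variance
is `β(r)`. Since `X` charges both `0` and `1`, `|φ(t)| ≤ exp (-κ t ^ 2)` on `[-π, π]`, while
`φ(t)` differs from `exp (-β t ^ 2 / 2)` by `O(|t| ^ 3)`; dominated convergence then yields the
local limit estimate `tendsto_sqrt_mul_integral_pow_sub`, and with it `tendsto_gammaExpCoeff`. The
forests are the case `k = 1`. The trees are the case `w = 0`, `k = 2`, in which `r = α_Δ`; Stirling's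
formula turns `(n - 2)!` into the form stated.
-/

/-! ### Graphs with one extra vertex -/

section Cone

variable {V : Type*}

/-- The graph obtained from `G` by adding a new vertex `none`, joined to the vertices in `R`. -/
def coneGraph (G : SimpleGraph V) (R : Finset V) : SimpleGraph (Option V) where
  Adj
    | none, none => False
    | none, some v => v ∈ R
    | some v, none => v ∈ R
    | some u, some v => G.Adj u v
  symm := ⟨by
    rintro (_ | u) (_ | v) h
    · exact h
    · exact h
    · exact h
    · exact SimpleGraph.Adj.symm (G := G) h⟩
  loopless := ⟨by
    rintro (_ | u) h
    · exact h
    · exact G.irrefl h⟩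

variable (G : SimpleGraph V) (R : Finset V)

@[simp] lemma coneGraph_adj_none_some (v : V) : (coneGraph G R).Adj none (some v) ↔ v ∈ R :=
  Iff.rfl

@[simp] lemma coneGraph_adj_some_none (v : V) : (coneGraph G R).Adj (some v) none ↔ v ∈ R :=
  Iff.rfl

@[simp] lemma coneGraph_adj_some_some (u v : V) :
    (coneGraph G R).Adj (some u) (some v) ↔ G.Adj u v :=
  Iff.rfl

lemma coneGraph_injective :
    Function.Injective fun p : SimpleGraph V × Finset V => coneGraph p.1 p.2 := by
  rintro ⟨G, R⟩ ⟨G', R'⟩ h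
  refine Prod.ext (SimpleGraph.ext ?_) (Finset.ext fun v => ?_)
  · funext u v
    rw [← coneGraph_adj_some_some G R, ← coneGraph_adj_some_some G' R']
    exact congrArg (fun H : SimpleGraph (Option V) => H.Adj (some u) (some v)) h
  · rw [← coneGraph_adj_none_some G R, ← coneGraph_adj_none_some G' R']
    exact iff_of_eq (congrArg (fun H : SimpleGraph (Option V) => H.Adj none (some v)) h)

lemma coneGraph_surjective [Finite V] :
    Function.Surjective fun p : SimpleGraph V × Finset V => coneGraph p.1 p.2 := by
  classical
  have := Fintype.ofFinite V
  intro H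
  refine ⟨(H.comap some, Finset.univ.filter fun v => H.Adj none (some v)),
    SimpleGraph.ext ?_⟩
  funext a b
  rcases a with _ | u <;> rcases b with _ | v
  · simp
  · simp
  · simp [H.adj_comm]
  · simp

lemma ncard_neighborSet_coneGraph_none :
    ((coneGraph G R).neighborSet none).ncard = R.card := by
  have : (coneGraph G R).neighborSet none = some '' (R : Set V) := by
    ext (_ | v) <;> simp [SimpleGraph.mem_neighborSet]
  rw [this, Set.ncard_image_of_injective _ (Option.some_injective V), Set.ncard_coe_finset]

lemma ncard_neighborSet_coneGraph_some [Finite V] [DecidableEq V] (v : V) :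
    ((coneGraph G R).neighborSet (some v)).ncard =
      (G.neighborSet v).ncard + if v ∈ R then 1 else 0 := by
  have : (coneGraph G R).neighborSet (some v) =
      some '' (G.neighborSet v) ∪ if v ∈ R then {none} else ∅ := by
    ext (_ | u) <;> by_cases h : v ∈ R <;> simp [SimpleGraph.mem_neighborSet, h]
  rw [this, Set.ncard_union_eq, Set.ncard_image_of_injective _ (Option.some_injective V)]
  · split_ifs <;> simp
  · split_ifs <;> simp

variable {G R}

/-- The original graph sits inside the extended graph. -/
def coneGraphHom (G : SimpleGraph V) (R : Finset V) : G →g coneGraph G R :=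
  ⟨some, fun h => h⟩

lemma exists_reachable_of_reachable_coneGraph_none {v : V}
    (h : (coneGraph G R).Reachable (some v) none) : ∃ u ∈ R, G.Reachable v u := by
  obtain ⟨p⟩ := h
  generalize ha : some v = a at p
  generalize hb : none = b at p
  induction p generalizing v with
  | nil => simp [← hb] at ha
  | @cons a c b h q ih =>
    subst ha
    cases c with
    | none => exact ⟨v, h, SimpleGraph.Reachable.refl _⟩
    | some x =>
      obtain ⟨u, hu, hxu⟩ := ih rfl hb
      exact ⟨u, hu, (SimpleGraph.Adj.reachable (G := G) h).trans hxu⟩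

/-- A walk between old vertices either stays in the old graph or visits the extra vertex. -/
lemma reachable_or_of_reachable_coneGraph_some {u v : V}
    (h : (coneGraph G R).Reachable (some u) (some v)) :
    G.Reachable u v ∨ (coneGraph G R).Reachable (some u) none := by
  obtain ⟨p⟩ := h
  generalize ha : some u = a at p
  generalize hb : some v = b at p
  induction p generalizing u with
  | nil =>
    obtain rfl : u = v := by simpa using ha.trans hb.symm
    exact Or.inl (SimpleGraph.Reachable.refl _)
  | @cons a c b h q ih =>
    subst ha
    cases c with
    | none => exact Or.inr h.reachable
    | some x =>
      rcases ih rfl hb with hx | hx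
      · exact Or.inl ((SimpleGraph.Adj.reachable (G := G) h).trans hx)
      · exact Or.inr (h.reachable.trans hx)

lemma coneGraph_connected_iff :
    (coneGraph G R).Connected ↔ ∀ v, ∃ u ∈ R, G.Reachable v u := by
  refine ⟨fun h v => exists_reachable_of_reachable_coneGraph_none (h.preconnected _ _), fun h => ?_⟩
  have key : ∀ a, (coneGraph G R).Reachable a none := by
    rintro (_ | v)
    · exact SimpleGraph.Reachable.refl _
    · obtain ⟨u, hu, hvu⟩ := h v
      exact (hvu.map (coneGraphHom G R)).trans
        (SimpleGraph.Adj.reachable (G := coneGraph G R) hu)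
  exact (SimpleGraph.connected_iff _).2 ⟨fun a b => (key a).trans (key b).symm, ⟨none⟩⟩

/-- Rooted forests are the trees with a distinguished extra vertex removed: the components of the
forest are the branches at the extra vertex, and the roots are its neighbours. -/
lemma coneGraph_isTree_iff :
    (coneGraph G R).IsTree ↔ G.IsAcyclic ∧
      ∀ c : G.ConnectedComponent, ∃! v, v ∈ R ∧ G.connectedComponentMk v = c := by
  classical
  constructor
  · intro hT
    refine ⟨hT.isAcyclic.comap (coneGraphHom G R) (Option.some_injective V), fun c => ?_⟩
    induction c using SimpleGraph.ConnectedComponent.ind with | _ v => ?_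
    obtain ⟨u, hu, hvu⟩ := coneGraph_connected_iff.1 hT.connected v
    refine ⟨u, ⟨hu, SimpleGraph.ConnectedComponent.eq.2 hvu.symm⟩, fun x hx => ?_⟩
    by_contra hxu
    have hxu' : G.Reachable x u := (SimpleGraph.ConnectedComponent.eq.1 hx.2).trans hvu
    obtain ⟨p, hp⟩ := hxu'.exists_isPath
    -- The path inside `G` and the path through the extra vertex would be distinct.
    let p' : (coneGraph G R).Walk (some x) (some u) := p.map (coneGraphHom G R)
    have hp' : p'.IsPath := hp.map (Option.some_injective V)
    have h1 : (coneGraph G R).Adj (some x) none := hx.1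
    have h2 : (coneGraph G R).Adj none (some u) := hu
    let q : (coneGraph G R).Walk (some x) (some u) := .cons h1 (.cons h2 .nil)
    have hq : q.IsPath := by
      simp [q, SimpleGraph.Walk.isPath_def, hxu]
    have heq : p' = q := congrArg Subtype.val
      ((hT.isAcyclic.subsingleton_path (some x) (some u)).elim ⟨p', hp'⟩ ⟨q, hq⟩)
    have hq' : (none : Option V) ∈ q.support := by simp [q]
    rw [← heq] at hq'
    have hmem : (none : Option V) ∈ p.support.map (coneGraphHom G R) :=
      (SimpleGraph.Walk.support_map (coneGraphHom G R) p) ▸ hq'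
    rw [List.mem_map] at hmem
    obtain ⟨y, -, hy⟩ := hmem
    exact Option.some_ne_none y hy
  · rintro ⟨hG, hR⟩
    have huniq : ∀ {x y}, x ∈ R → y ∈ R → G.Reachable x y → x = y := fun {x y} hx hy h =>
      (hR (G.connectedComponentMk y)).unique ⟨hx, SimpleGraph.ConnectedComponent.eq.2 h⟩ ⟨hy, rfl⟩
    have hnone : ∀ v, (coneGraph G R).Adj (some v) none →
        (coneGraph G R).IsBridge s(some v, none) := by
      intro v hv
      rw [SimpleGraph.isBridge_iff]
      intro h
      have hle : (coneGraph G R).deleteEdges {s(some v, none)} ≤ coneGraph G (R.erase v) := by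
        rintro (_ | a) (_ | b) hab
        · simp at hab
        · simp only [SimpleGraph.deleteEdges_adj, coneGraph_adj_none_some] at hab
          simpa [hab.1, eq_comm] using hab.2
        · simp only [SimpleGraph.deleteEdges_adj, coneGraph_adj_some_none] at hab
          simpa [hab.1] using hab.2
        · exact hab.1
      obtain ⟨u, hu, hvu⟩ := exists_reachable_of_reachable_coneGraph_none (h.mono hle)
      exact (Finset.mem_erase.1 hu).1 (huniq (Finset.mem_erase.1 hu).2 hv hvu.symm)
    refine ⟨coneGraph_connected_iff.2 fun v => ?_, ?_⟩
    · obtain ⟨u, ⟨hu, huv⟩, -⟩ := hR (G.connectedComponentMk v)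
      exact ⟨u, hu, SimpleGraph.ConnectedComponent.eq.1 huv.symm⟩
    rw [SimpleGraph.isAcyclic_iff_forall_adj_isBridge]
    rintro (_ | u) (_ | v) huv
    · simp at huv
    · rw [Sym2.eq_swap]
      exact hnone v huv.symm
    · exact hnone u huv
    · have hb := SimpleGraph.isAcyclic_iff_forall_adj_isBridge.1 hG
        (show G.Adj u v from huv)
      rw [SimpleGraph.isBridge_iff] at hb ⊢
      intro h
      have hle : (coneGraph G R).deleteEdges {s(some u, some v)} ≤
          coneGraph (G.deleteEdges {s(u, v)}) R := by
        rintro (_ | a) (_ | b) hab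
        · simp at hab
        · exact hab.1
        · exact hab.1
        · simpa using hab
      have hsub : G.deleteEdges {s(u, v)} ≤ G := SimpleGraph.deleteEdges_le _
      have h' := h.mono hle
      rcases reachable_or_of_reachable_coneGraph_some h' with hr | hr
      · exact hb hr
      · obtain ⟨x, hx, hux⟩ := exists_reachable_of_reachable_coneGraph_none hr
        obtain ⟨y, hy, hvy⟩ := exists_reachable_of_reachable_coneGraph_none (h'.symm.trans hr)
        obtain rfl : x = y := huniq hx hy
          (((hux.mono hsub).symm.trans (SimpleGraph.Adj.reachable (G := G) huv)).trans
            (hvy.mono hsub))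
        exact hb (hux.trans hvy.symm)

end Cone

/-! ### Trees with a given degree sequence -/

section DegreeSequence

/-- The number of connected graphs on `V` in which every vertex `v` has degree `e v + 1`. When
`∑ v, e v + 2 = |V|` these are the trees with that degree sequence. -/
noncomputable def connectedCount {V : Type*} (e : V → ℕ) : ℕ :=
  Nat.card {G : SimpleGraph V // G.Connected ∧ ∀ v, (G.neighborSet v).ncard = e v + 1}

lemma ncard_neighborSet_of_iso {V W : Type*} {G : SimpleGraph V} {H : SimpleGraph W}
    (f : G ≃g H) (v : V) : (H.neighborSet (f v)).ncard = (G.neighborSet v).ncard := by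
  have h : H.neighborSet (f v) = f '' G.neighborSet v := by
    ext w
    obtain ⟨w, rfl⟩ := f.surjective w
    exact f.map_adj_iff.trans f.injective.mem_set_image.symm
  rw [h, Set.ncard_image_of_injective _ f.injective]

lemma connectedCount_comp_equiv {V W : Type*} (φ : W ≃ V) (e : V → ℕ) :
    connectedCount (e ∘ φ) = connectedCount e := by
  refine Nat.card_congr (Equiv.subtypeEquiv φ.simpleGraph fun G => ?_)
  let f : G ≃g φ.simpleGraph G := (SimpleGraph.Iso.comap φ.symm G).symm
  have hf : ∀ w, f w = φ w := fun w => rfl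
  rw [f.connected_iff]
  refine and_congr_right fun _ => ⟨fun h v => ?_, fun h w => ?_⟩
  · obtain ⟨w, rfl⟩ := φ.surjective v
    rw [← hf, ncard_neighborSet_of_iso, h]
    rfl
  · rw [← ncard_neighborSet_of_iso f, hf, h]
    rfl

lemma connectedCount_of_card_eq_two {V : Type*} [Fintype V] (hV : Fintype.card V = 2)
    {e : V → ℕ} (he : ∀ v, e v = 0) : connectedCount e = 1 := by
  have : Nonempty V := Fintype.card_pos_iff.1 (by omega)
  have key : ∀ G : SimpleGraph V,
      (G.Connected ∧ ∀ v, (G.neighborSet v).ncard = e v + 1) ↔ G = ⊤ := by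
    intro G
    constructor
    · rintro ⟨-, h⟩
      refine eq_top_iff.2 fun u v huv => ?_
      rw [SimpleGraph.top_adj] at huv
      have hpos : (G.neighborSet u).Nonempty := by
        rw [← Set.ncard_pos (Set.toFinite _), h u]
        omega
      obtain ⟨w, hw⟩ := hpos
      have hwu : u ≠ w := G.ne_of_adj hw
      have hwv : w = v := by
        by_contra hne
        classical
        have := Finset.card_le_univ ({u, v, w} : Finset V)
        rw [Finset.card_eq_three.2 ⟨u, v, w, huv, hwu, Ne.symm hne, rfl⟩] at this
        omega
      exact hwv ▸ hw
    · rintro rfl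
      refine ⟨SimpleGraph.connected_top, fun v => ?_⟩
      have h : (⊤ : SimpleGraph V).neighborSet v = {v}ᶜ := by
        ext w
        simp [eq_comm]
      rw [h, Set.ncard_compl, Set.ncard_singleton, Nat.card_eq_fintype_card, hV, he]
  unfold connectedCount
  simp_rw [key]
  exact Nat.card_unique

/-- Removing a leaf, here the extra vertex, from a tree, and summing over its neighbour `u`. -/
lemma connectedCount_option {W : Type*} [Fintype W] [DecidableEq W] {e : Option W → ℕ} (h0 : e none = 0) :
    connectedCount e = ∑ u : W, Nat.card {H : SimpleGraph W // H.Connected ∧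
      ∀ v, (H.neighborSet v).ncard + (if v = u then 1 else 0) = e (some v) + 1} := by
  rw [← Nat.card_sigma]
  symm
  have hprop : ∀ (u : W) (H : SimpleGraph W),
      (H.Connected ∧
        ∀ v, (H.neighborSet v).ncard + (if v = u then 1 else 0) = e (some v) + 1) ↔
      ((coneGraph H {u}).Connected ∧
        ∀ v, ((coneGraph H {u}).neighborSet v).ncard = e v + 1) := by
    intro u H
    rw [coneGraph_connected_iff, Option.forall]
    simp only [ncard_neighborSet_coneGraph_none, ncard_neighborSet_coneGraph_some,
      Finset.card_singleton, Finset.mem_singleton, h0, exists_eq_left, zero_add, true_and]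
    refine and_congr_left fun _ => ⟨fun h v => h.preconnected v u, fun h => ?_⟩
    exact (SimpleGraph.connected_iff _).2 ⟨fun a b => (h a).trans (h b).symm, ⟨u⟩⟩
  refine Nat.card_congr (Equiv.ofBijective
    (fun p => ⟨coneGraph p.2.1 {p.1}, (hprop p.1 p.2.1).1 p.2.2⟩) ⟨?_, ?_⟩)
  · rintro ⟨u, H, hH⟩ ⟨u', H', hH'⟩ h
    have h' := @coneGraph_injective W (H, {u}) (H', {u'}) (congrArg Subtype.val h)
    simp only [Prod.mk.injEq, Finset.singleton_inj] at h'
    obtain ⟨rfl, rfl⟩ := h'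
    rfl
  · rintro ⟨G, hG⟩
    obtain ⟨⟨H, R⟩, rfl⟩ := coneGraph_surjective G
    have hR := hG.2 none
    simp only [ncard_neighborSet_coneGraph_none, h0, zero_add] at hR
    obtain ⟨u, rfl⟩ := Finset.card_eq_one.1 hR
    exact ⟨⟨u, H, (hprop u H).2 hG⟩, rfl⟩

/-- The number of trees with degrees `e v + 1` is the multinomial coefficient
`(|V| - 2)! / ∏ v, (e v)!`. -/
lemma connectedCount_mul_prod_factorial (n : ℕ) {V : Type*} [Fintype V]
    (hV : Fintype.card V = n + 2) (e : V → ℕ) (he : ∑ v, e v = n) :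
    connectedCount e * ∏ v, (e v).factorial = n.factorial := by
  classical
  induction n generalizing V with
  | zero =>
    have he' : ∀ v, e v = 0 := by simpa using he
    simp [connectedCount_of_card_eq_two hV he', he']
  | succ n ih =>
    obtain ⟨x, hx⟩ : ∃ x, e x = 0 := by
      by_contra! h
      have : ∑ _v : V, 1 ≤ ∑ v, e v :=
        Finset.sum_le_sum fun v _ => Nat.one_le_iff_ne_zero.2 (h v)
      simp at this
      omega
    let W := {a // a ≠ x}
    let φ : Option W ≃ V := Equiv.optionSubtypeNe x
    have hφ : φ none = x := Equiv.optionSubtypeNe_none x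
    have hW : Fintype.card W = n + 2 := by
      have := Fintype.card_congr φ
      rw [Fintype.card_option] at this
      omega
    rw [← connectedCount_comp_equiv φ, ← φ.prod_comp fun v => (e v).factorial]
    rw [← φ.sum_comp e] at he
    set d : Option W → ℕ := e ∘ φ with hd
    change connectedCount d * ∏ a, (d a).factorial = _
    change ∑ a, d a = _ at he
    have hd0 : d none = 0 := by simp [hd, hφ, hx]
    rw [Fintype.sum_option, hd0, zero_add] at he
    rw [connectedCount_option hd0, Fintype.prod_option, hd0, Nat.factorial_zero, one_mul,
      Finset.sum_mul, Nat.factorial_succ, ← he, Finset.sum_mul]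
    refine Finset.sum_congr rfl fun u _ => ?_
    have hnt : Nontrivial W := Fintype.one_lt_card_iff_nontrivial.1 (by omega)
    rcases Nat.eq_zero_or_pos (d (some u)) with hu | hu
    · -- A neighbour of the leaf has degree at least two.
      rw [hu, zero_mul, mul_eq_zero]
      left
      refine Nat.card_eq_zero.2 (Or.inl ⟨?_⟩)
      rintro ⟨H, hH, hdeg⟩
      have h1 := hdeg u
      rw [if_pos rfl, hu, zero_add, Nat.add_eq_right, Set.ncard_eq_zero (Set.toFinite _)] at h1
      obtain ⟨y, hy⟩ := hH.preconnected.exists_adj_of_nontrivial u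
      exact (h1 ▸ hy : y ∈ (∅ : Set W))
    · let c : W → ℕ := fun v => if v = u then d (some u) - 1 else d (some v)
      have hc : ∀ v, d (some v) = c v + if v = u then 1 else 0 := by
        intro v
        by_cases h : v = u
        · subst h; simp [c]; omega
        · simp [c, h]
      have hcount : Nat.card {H : SimpleGraph W // H.Connected ∧
          ∀ v, (H.neighborSet v).ncard + (if v = u then 1 else 0) = d (some v) + 1} =
          connectedCount c := by
        unfold connectedCount
        congr 1
        congr 1
        ext H
        refine and_congr_right fun _ => forall_congr' fun v => ?_
        rw [hc v]
        omega
      have hcsum : ∑ v, c v = n := by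
        have : ∑ v, d (some v) = ∑ v, c v + 1 := by
          simp_rw [hc]
          rw [Finset.sum_add_distrib, Finset.sum_ite_eq' Finset.univ u, if_pos (Finset.mem_univ u)]
        omega
      have hprod : ∏ v, (d (some v)).factorial = d (some u) * ∏ v, (c v).factorial := by
        rw [← Finset.mul_prod_erase _ _ (Finset.mem_univ u),
          ← Finset.mul_prod_erase _ (fun v => (c v).factorial) (Finset.mem_univ u), ← mul_assoc]
        congr 1
        · simp only [c, if_true]
          exact (Nat.mul_factorial_pred hu.ne').symm
        · refine Finset.prod_congr rfl fun v hv => ?_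
          simp [c, Finset.ne_of_mem_erase hv]
      rw [hcount, hprod, mul_left_comm, ih hW c hcsum]

lemma isTree_iff_connected_of_degree {V : Type*} [Fintype V] {n : ℕ}
    (hV : Fintype.card V = n + 2) {e : V → ℕ} {G : SimpleGraph V}
    (hG : ∀ v, (G.neighborSet v).ncard = e v + 1) :
    G.IsTree ↔ G.Connected ∧ ∑ v, e v = n := by
  classical
  have hdeg : ∀ v, G.degree v = e v + 1 := fun v => by
    rw [← hG v, ← SimpleGraph.card_neighborSet_eq_degree, Set.ncard_eq_toFinset_card',
      Set.toFinset_card]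
  have hsum := G.sum_degrees_eq_twice_card_edges
  simp only [hdeg, Finset.sum_add_distrib, Finset.sum_const, Finset.card_univ, hV, smul_eq_mul,
    mul_one] at hsum
  rw [SimpleGraph.isTree_iff_connected_and_card, Nat.card_eq_fintype_card,
    Nat.card_eq_fintype_card, hV, ← SimpleGraph.edgeFinset_card]
  refine and_congr_right fun _ => ?_
  omega

/-- The number of trees in which each degree, lowered by one, lies in a prescribed finite set. -/
lemma card_trees_degree_mem {V : Type*} [Fintype V] [DecidableEq V] {n : ℕ} (hV : Fintype.card V = n + 2)
    (S : V → Finset ℕ) :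
    (Nat.card {G : SimpleGraph V // G.IsTree ∧
      ∀ v, ∃ k ∈ S v, (G.neighborSet v).ncard = k + 1} : ℝ) =
      n.factorial * ∑ e ∈ Fintype.piFinset S with ∑ v, e v = n,
        ∏ v, ((e v).factorial : ℝ)⁻¹ := by
  have hcard : Nat.card {G : SimpleGraph V // G.IsTree ∧
      ∀ v, ∃ k ∈ S v, (G.neighborSet v).ncard = k + 1} =
      ∑ e ∈ Fintype.piFinset S with ∑ v, e v = n, connectedCount e := by
    rw [← Finset.sum_coe_sort]
    unfold connectedCount
    rw [← Nat.card_sigma]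
    symm
    refine Nat.card_congr (Equiv.ofBijective (fun p => ⟨p.2.1, ?_, ?_⟩) ⟨?_, ?_⟩)
    · exact (isTree_iff_connected_of_degree hV p.2.2.2).2
        ⟨p.2.2.1, (Finset.mem_filter.1 p.1.2).2⟩
    · exact fun v => ⟨p.1.1 v, Fintype.mem_piFinset.1 (Finset.mem_filter.1 p.1.2).1 v, p.2.2.2 v⟩
    · rintro ⟨⟨e, he⟩, G, hG⟩ ⟨⟨e', he'⟩, G', hG'⟩ h
      obtain rfl : G = G' := congrArg Subtype.val h
      obtain rfl : e = e' := by
        funext v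
        have := (hG.2 v).symm.trans (hG'.2 v)
        simpa using this
      rfl
    · rintro ⟨G, hG, hS⟩
      choose e he hdeg using id hS
      have := (isTree_iff_connected_of_degree hV hdeg).1 hG
      exact ⟨⟨⟨e, Finset.mem_filter.2 ⟨Fintype.mem_piFinset.2 he, this.2⟩⟩, G, this.1, hdeg⟩, rfl⟩
  rw [hcard, Nat.cast_sum, Finset.mul_sum]
  refine Finset.sum_congr rfl fun e he => ?_
  rw [Finset.prod_inv_distrib, ← div_eq_mul_inv, eq_div_iff, ← Nat.cast_prod, ← Nat.cast_mul,
    connectedCount_mul_prod_factorial n hV e (Finset.mem_filter.1 he).2]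
  exact Finset.prod_ne_zero_iff.2 fun v _ => Nat.cast_ne_zero.2 (Nat.factorial_ne_zero _)

end DegreeSequence

/-! ### Bounded-degree trees and forests as coefficients -/

section Counting

/-- The coefficient of `x ^ N` in `γ_Δ(x) ^ n`, written as a sum over the exponents
chosen in the `n` factors. -/
noncomputable def gammaPowCoeff (Δ n N : ℕ) : ℝ :=
  ∑ e ∈ Fintype.piFinset (fun _ : Fin n => Finset.range Δ) with ∑ v, e v = N,
    ∏ v, ((e v).factorial : ℝ)⁻¹

lemma ncard_neighborSet_eq_degree {V : Type*} (G : SimpleGraph V) (v : V)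
    [Fintype (G.neighborSet v)] : (G.neighborSet v).ncard = G.degree v := by
  rw [← SimpleGraph.card_neighborSet_eq_degree, Set.ncard_eq_toFinset_card', Set.toFinset_card]

lemma one_le_ncard_neighborSet_of_isTree {V : Type*} [Finite V] [Nontrivial V]
    {G : SimpleGraph V} (hG : G.IsTree) (v : V) : 1 ≤ (G.neighborSet v).ncard := by
  rw [Nat.one_le_iff_ne_zero, Ne, Set.ncard_eq_zero (Set.toFinite _), ← Ne,
    ← Set.nonempty_iff_ne_empty]
  exact hG.connected.preconnected.exists_adj_of_nontrivial v

lemma treeCount_eq (Δ n : ℕ) :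
    (treeCount Δ (n + 2) : ℝ) = n.factorial * gammaPowCoeff Δ (n + 2) n := by
  refine Eq.trans ?_ (card_trees_degree_mem (Fintype.card_fin (n + 2)) fun _ => Finset.range Δ)
  rw [treeCount]
  congr 2
  congr 1
  ext G
  refine and_congr_right fun hG => forall_congr' fun v => ?_
  have h1 := one_le_ncard_neighborSet_of_isTree hG v
  rw [← ncard_neighborSet_eq_degree]
  constructor
  · exact fun h => ⟨(G.neighborSet v).ncard - 1, Finset.mem_range.2 (by omega), by omega⟩
  · rintro ⟨k, hk, h⟩
    rw [Finset.mem_range] at hk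
    omega

lemma isBoundedRootedForest_iff {Δ m n : ℕ} (hΔ : 1 ≤ Δ) {G : SimpleGraph (Fin n)}
    {R : Finset (Fin n)} :
    IsBoundedRootedForest Δ m G R ↔ (coneGraph G R).IsTree ∧
      ((coneGraph G R).neighborSet none).ncard = m ∧
      ∀ v, ((coneGraph G R).neighborSet (some v)).ncard ≤ Δ := by
  unfold IsBoundedRootedForest
  rw [coneGraph_isTree_iff, and_assoc]
  refine and_congr_right fun _ => and_congr_right fun hR => and_congr ?_ ?_
  · rw [ncard_neighborSet_coneGraph_none]
    have hcard : Nat.card G.ConnectedComponent = R.card := by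
      rw [← Fintype.card_coe R, ← Nat.card_eq_fintype_card]
      symm
      refine Nat.card_congr (Equiv.ofBijective (fun v : R => G.connectedComponentMk v.1) ⟨?_, ?_⟩)
      · intro u v h
        exact Subtype.ext ((hR (G.connectedComponentMk v.1)).unique ⟨u.2, h⟩ ⟨v.2, rfl⟩)
      · intro c
        obtain ⟨v, ⟨hv, hc⟩, -⟩ := hR c
        exact ⟨⟨v, hv⟩, hc⟩
    rw [hcard]
  · rw [← forall_and]
    refine forall_congr' fun v => ?_
    rw [ncard_neighborSet_coneGraph_some, ← ncard_neighborSet_eq_degree]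
    by_cases hv : v ∈ R
    · simp only [hv, if_true, forall_const]
      omega
    · simp [hv]

lemma rootedForestCount_eq {Δ n m : ℕ} (hΔ : 1 ≤ Δ) (hm : 1 ≤ m) (hmn : m ≤ n) :
    (rootedForestCount Δ n m : ℝ) =
      (n - 1).factorial / (m - 1).factorial * gammaPowCoeff Δ n (n - m) := by
  classical
  let S : Option (Fin n) → Finset ℕ := fun a => a.elim {m - 1} fun _ => Finset.range Δ
  have hV : Fintype.card (Option (Fin n)) = n - 1 + 2 := by
    rw [Fintype.card_option, Fintype.card_fin]
    omega
  have hnt : Nontrivial (Option (Fin n)) := Fintype.one_lt_card_iff_nontrivial.1 (by omega)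
  have hcard : rootedForestCount Δ n m = Nat.card {G : SimpleGraph (Option (Fin n)) //
      G.IsTree ∧ ∀ v, ∃ k ∈ S v, (G.neighborSet v).ncard = k + 1} := by
    refine Nat.card_congr (Equiv.subtypeEquiv
      (Equiv.ofBijective _ ⟨coneGraph_injective, coneGraph_surjective⟩) fun F => ?_)
    rw [isBoundedRootedForest_iff hΔ]
    change _ ↔ (coneGraph F.1 F.2).IsTree ∧
      ∀ v, ∃ k ∈ S v, ((coneGraph F.1 F.2).neighborSet v).ncard = k + 1
    refine and_congr_right fun hT => ?_
    rw [Option.forall]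
    refine and_congr ?_ (forall_congr' fun v => ?_)
    · simp only [S, Option.elim_none, Finset.mem_singleton, exists_eq_left]
      omega
    · have h1 := one_le_ncard_neighborSet_of_isTree hT (some v)
      simp only [S, Option.elim_some, Finset.mem_range]
      constructor
      · exact fun h => ⟨((coneGraph F.1 F.2).neighborSet (some v)).ncard - 1, by omega, by omega⟩
      · rintro ⟨k, hk, h⟩
        omega
  rw [hcard, card_trees_degree_mem hV, div_mul_eq_mul_div, mul_div_assoc]
  congr 1
  unfold gammaPowCoeff
  rw [Finset.sum_div]
  symm
  refine Finset.sum_bij' (fun e _ => fun a => a.elim (m - 1) e) (fun e _ => e ∘ some)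
    ?_ ?_ ?_ ?_ ?_
  · intro e he
    simp only [Finset.mem_filter, Fintype.mem_piFinset] at he ⊢
    refine ⟨?_, ?_⟩
    · rintro (_ | v)
      · simp [S]
      · exact he.1 v
    · rw [Fintype.sum_option]
      simp only [Option.elim_none, Option.elim_some, he.2]
      omega
  · intro e he
    simp only [Finset.mem_filter, Fintype.mem_piFinset] at he ⊢
    refine ⟨fun v => he.1 (some v), ?_⟩
    have h0 : e none = m - 1 := by simpa [S] using he.1 none
    have h := he.2
    rw [Fintype.sum_option, h0] at h
    simp only [Function.comp_apply]
    omega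
  · intro e he
    rfl
  · intro e he
    simp only [Finset.mem_filter, Fintype.mem_piFinset] at he
    have h0 : e none = m - 1 := by simpa [S] using he.1 none
    funext a
    cases a with
    | none => exact h0.symm
    | some v => rfl
  · intro e he
    rw [Fintype.prod_option]
    simp [div_eq_inv_mul]

lemma sum_rootedForestCount {Δ n : ℕ} (hΔ : 1 ≤ Δ) (w : ℝ) :
    ∑ m ∈ Finset.Icc 1 n, (rootedForestCount Δ n m : ℝ) * w ^ m =
      w * (n - 1).factorial *
        ∑ j ∈ Finset.range n, w ^ j / j.factorial * gammaPowCoeff Δ n (n - 1 - j) := by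
  rw [← Finset.Ico_add_one_right_eq_Icc, Finset.sum_Ico_eq_sum_range, Nat.add_sub_cancel,
    Finset.mul_sum]
  refine Finset.sum_congr rfl fun j hj => ?_
  rw [Finset.mem_range] at hj
  rw [rootedForestCount_eq hΔ (by omega) (by omega), Nat.add_sub_cancel_left, Nat.sub_sub,
    pow_add, pow_one]
  ring

end Counting

/-! ### The saddle-point equation -/

section Saddle

lemma hasDerivAt_gammaPoly (Δ : ℕ) (x : ℝ) :
    HasDerivAt (gammaPoly Δ) (gammaPoly (Δ - 1) x) x := by
  have h : HasDerivAt (fun y => ∑ k ∈ Finset.range Δ, y ^ k / (k.factorial : ℝ))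
      (∑ k ∈ Finset.range Δ, (k * x ^ (k - 1)) / (k.factorial : ℝ)) x :=
    HasDerivAt.fun_sum fun k _ => (hasDerivAt_pow k x).div_const _
  refine h.congr_deriv ?_
  cases Δ with
  | zero => simp [gammaPoly]
  | succ d =>
    rw [Finset.sum_range_succ', Nat.add_sub_cancel, gammaPoly]
    simp only [Nat.cast_zero, zero_mul, zero_div, add_zero, Nat.add_sub_cancel]
    refine Finset.sum_congr rfl fun k _ => ?_
    rw [Nat.factorial_succ, Nat.cast_mul, mul_div_mul_left]
    exact Nat.cast_ne_zero.2 k.succ_ne_zero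

lemma deriv_gammaPoly (Δ : ℕ) : deriv (gammaPoly Δ) = gammaPoly (Δ - 1) :=
  funext fun x => (hasDerivAt_gammaPoly Δ x).deriv

lemma continuous_gammaPoly (Δ : ℕ) : Continuous (gammaPoly Δ) :=
  continuous_iff_continuousAt.2 fun x => (hasDerivAt_gammaPoly Δ x).continuousAt

lemma gammaPoly_mono {d e : ℕ} (h : d ≤ e) {x : ℝ} (hx : 0 ≤ x) :
    gammaPoly d x ≤ gammaPoly e x :=
  Finset.sum_le_sum_of_subset_of_nonneg (Finset.range_mono h) fun _ _ _ => by positivity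

lemma one_le_gammaPoly {Δ : ℕ} (hΔ : 1 ≤ Δ) {x : ℝ} (hx : 0 ≤ x) : 1 ≤ gammaPoly Δ x := by
  simpa [gammaPoly] using gammaPoly_mono hΔ hx

lemma gammaPoly_pos {Δ : ℕ} (hΔ : 1 ≤ Δ) {x : ℝ} (hx : 0 ≤ x) : 0 < gammaPoly Δ x :=
  zero_lt_one.trans_le (one_le_gammaPoly hΔ hx)

lemma gammaPoly_le_exp (Δ : ℕ) {x : ℝ} (hx : 0 ≤ x) : gammaPoly Δ x ≤ Real.exp x :=
  Real.sum_le_exp_of_nonneg hx Δ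

lemma mul_gammaPoly_pred (Δ : ℕ) (x : ℝ) :
    x * gammaPoly (Δ - 1) x = ∑ k ∈ Finset.range Δ, k * (x ^ k / (k.factorial : ℝ)) := by
  cases Δ with
  | zero => simp [gammaPoly]
  | succ d =>
    rw [Finset.sum_range_succ', Nat.add_sub_cancel, gammaPoly, Finset.mul_sum]
    simp only [Nat.cast_zero, zero_mul, add_zero]
    refine Finset.sum_congr rfl fun k _ => ?_
    rw [Nat.factorial_succ, Nat.cast_mul]
    have : ((k + 1 : ℕ) : ℝ) ≠ 0 := Nat.cast_ne_zero.2 k.succ_ne_zero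
    have : (k.factorial : ℝ) ≠ 0 := Nat.cast_ne_zero.2 k.factorial_ne_zero
    field_simp
    ring

lemma sq_mul_gammaPoly_pred_pred (Δ : ℕ) (x : ℝ) :
    x ^ 2 * gammaPoly (Δ - 2) x =
      ∑ k ∈ Finset.range Δ, k * (k - 1) * (x ^ k / (k.factorial : ℝ)) := by
  have h : x ^ 2 * gammaPoly (Δ - 2) x = x * (x * gammaPoly (Δ - 1 - 1) x) := by
    rw [Nat.sub_sub]; ring
  rw [h, mul_gammaPoly_pred]
  cases Δ with
  | zero => simp
  | succ d =>
    rw [Finset.sum_range_succ' _ d, Nat.add_sub_cancel, Finset.mul_sum]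
    simp only [Nat.cast_zero, zero_mul, add_zero]
    refine Finset.sum_congr rfl fun k _ => ?_
    rw [Nat.factorial_succ, Nat.cast_mul]
    push_cast
    have : (k + 1 : ℝ) ≠ 0 := k.cast_add_one_ne_zero
    have : (k.factorial : ℝ) ≠ 0 := Nat.cast_ne_zero.2 k.factorial_ne_zero
    field_simp
    ring

/-- The saddle-point equation `x γ_Δ'(x) / γ_Δ(x) + c x = 1` for positive `x`, with the
denominator cleared. -/
def IsTilt (Δ : ℕ) (c r : ℝ) : Prop :=
  0 < r ∧ r * gammaPoly (Δ - 1) r + c * r * gammaPoly Δ r = gammaPoly Δ r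

/-- The truncated subtraction `k - 1` makes the constant term of the sum vanish. -/
lemma gammaPoly_sub_mul_gammaPoly_pred {Δ : ℕ} (hΔ : 1 ≤ Δ) (r : ℝ) :
    gammaPoly Δ r - r * gammaPoly (Δ - 1) r =
      1 - ∑ k ∈ Finset.range Δ, ((k - 1 : ℕ) : ℝ) * (r ^ k / (k.factorial : ℝ)) := by
  rw [mul_gammaPoly_pred, gammaPoly]
  obtain ⟨d, rfl⟩ : ∃ d, Δ = d + 1 := ⟨Δ - 1, by omega⟩
  rw [Finset.sum_range_succ', Finset.sum_range_succ' (fun k => (k : ℝ) * _),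
    Finset.sum_range_succ' (fun k => ((k - 1 : ℕ) : ℝ) * _)]
  simp only [Nat.add_sub_cancel, Nat.cast_add, Nat.cast_one, add_mul, one_mul,
    Finset.sum_add_distrib]
  simp
  ring

/-- The saddle-point equation says that a polynomial with non-negative coefficients takes the
value one. -/
lemma isTilt_iff {Δ : ℕ} (hΔ : 1 ≤ Δ) (c r : ℝ) :
    IsTilt Δ c r ↔ 0 < r ∧
      ∑ k ∈ Finset.range Δ, ((k - 1 : ℕ) : ℝ) * (r ^ k / (k.factorial : ℝ)) +
        c * r * gammaPoly Δ r = 1 := by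
  refine and_congr_right fun _ => ?_
  have h := gammaPoly_sub_mul_gammaPoly_pred hΔ r
  constructor <;> intro h' <;> linarith

lemma strictMonoOn_saddle {Δ : ℕ} (hΔ : 3 ≤ Δ) {c : ℝ} (hc : 0 ≤ c) :
    StrictMonoOn (fun r : ℝ =>
      ∑ k ∈ Finset.range Δ, ((k - 1 : ℕ) : ℝ) * (r ^ k / (k.factorial : ℝ)) +
        c * r * gammaPoly Δ r) (Set.Ici 0) := by
  intro x hx y hy hxy
  rw [Set.mem_Ici] at hx hy
  have hterm : ∀ k, x ^ k / (k.factorial : ℝ) ≤ y ^ k / (k.factorial : ℝ) := fun k => by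
    have := pow_le_pow_left₀ hx hxy.le k
    gcongr
  refine add_lt_add_of_lt_of_le (Finset.sum_lt_sum (fun k _ => ?_) ⟨2, ?_, ?_⟩) ?_
  · exact mul_le_mul_of_nonneg_left (hterm k) (Nat.cast_nonneg _)
  · exact Finset.mem_range.2 (by omega)
  · have := pow_lt_pow_left₀ hxy hx two_ne_zero
    norm_num
    linarith
  · have h1 : gammaPoly Δ x ≤ gammaPoly Δ y := Finset.sum_le_sum fun k _ => hterm k
    have h2 : 0 ≤ gammaPoly Δ x := (gammaPoly_pos (by omega) hx).le
    exact mul_le_mul (mul_le_mul_of_nonneg_left hxy.le hc) h1 h2 (mul_nonneg hc hy)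

lemma sq_div_two_le_saddle {Δ : ℕ} (hΔ : 3 ≤ Δ) {r : ℝ} (hr : 0 ≤ r) :
    r ^ 2 / 2 ≤ ∑ k ∈ Finset.range Δ, ((k - 1 : ℕ) : ℝ) * (r ^ k / (k.factorial : ℝ)) := by
  have := Finset.single_le_sum (s := Finset.range Δ)
    (f := fun k => ((k - 1 : ℕ) : ℝ) * (r ^ k / (k.factorial : ℝ)))
    (fun k _ => by positivity) (Finset.mem_range.2 (show 2 < Δ by omega))
  simpa using this

lemma existsUnique_isTilt {Δ : ℕ} (hΔ : 3 ≤ Δ) {c : ℝ} (hc : 0 ≤ c) :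
    ∃! r, IsTilt Δ c r := by
  have hΔ' : 1 ≤ Δ := by omega
  simp_rw [isTilt_iff hΔ']
  set f := fun r : ℝ => ∑ k ∈ Finset.range Δ, ((k - 1 : ℕ) : ℝ) * (r ^ k / (k.factorial : ℝ)) +
        c * r * gammaPoly Δ r with hf
  have hcont : Continuous f := by
    have := continuous_gammaPoly Δ
    fun_prop
  have h0 : f 0 = 0 := by
    simp only [hf, mul_zero, zero_mul, add_zero]
    refine Finset.sum_eq_zero fun k _ => ?_
    rcases k with _ | k <;> simp
  have h2 : 1 ≤ f 2 := by
    have h := sq_div_two_le_saddle hΔ (zero_le_two (α := ℝ))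
    have h' : 0 ≤ c * 2 * gammaPoly Δ 2 :=
      mul_nonneg (by positivity) (gammaPoly_pos hΔ' zero_le_two).le
    simp only [hf]
    linarith
  obtain ⟨r, hr, hfr⟩ := intermediate_value_Icc (zero_le_two (α := ℝ)) hcont.continuousOn
    (show (1 : ℝ) ∈ Set.Icc (f 0) (f 2) from ⟨by rw [h0]; exact zero_le_one, h2⟩)
  have hr0 : r ≠ 0 := by
    rintro rfl
    rw [h0] at hfr
    exact zero_ne_one hfr
  refine ⟨r, ⟨lt_of_le_of_ne hr.1 hr0.symm, hfr⟩, fun y hy => ?_⟩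
  exact (strictMonoOn_saddle hΔ hc).injOn hy.1.le hr.1 (hy.2.trans hfr.symm)

lemma IsTilt.le_two {Δ : ℕ} (hΔ : 3 ≤ Δ) {c r : ℝ} (hc : 0 ≤ c) (h : IsTilt Δ c r) : r ≤ 2 := by
  obtain ⟨hr, h⟩ := (isTilt_iff (by omega) c r).1 h
  have h1 := sq_div_two_le_saddle hΔ hr.le
  have h2 : 0 ≤ c * r * gammaPoly Δ r :=
    mul_nonneg (by positivity) (gammaPoly_pos (by omega) hr.le).le
  nlinarith

lemma IsTilt.half_le {Δ : ℕ} (hΔ : 3 ≤ Δ) {c r : ℝ} (hc : c ≤ 1) (h : IsTilt Δ c r) :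
    1 / 2 ≤ r := by
  obtain ⟨hr, h⟩ := h
  have h1 := gammaPoly_mono (Nat.sub_le Δ 1) hr.le
  have h2 : 0 < gammaPoly Δ r := gammaPoly_pos (by omega) hr.le
  have h3 : r * gammaPoly (Δ - 1) r ≤ r * gammaPoly Δ r := by gcongr
  have h4 : c * r * gammaPoly Δ r ≤ 1 * r * gammaPoly Δ r := by gcongr
  have h5 : 1 * gammaPoly Δ r ≤ (2 * r) * gammaPoly Δ r := by linarith
  have := le_of_mul_le_mul_right h5 h2
  linarith

lemma isSaddlePoint_iff {Δ n : ℕ} (hΔ : 1 ≤ Δ) (w r : ℝ) :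
    IsSaddlePoint Δ n w r ↔ IsTilt Δ (w / n) r := by
  unfold IsSaddlePoint IsTilt
  refine and_congr_right fun hr => ?_
  have h := (gammaPoly_pos hΔ hr.le).ne'
  rw [deriv_gammaPoly, ← mul_left_inj' h, add_mul, div_mul_cancel₀ _ h, one_mul,
    mul_comm r w, mul_div_right_comm]

lemma isAlpha_iff {Δ : ℕ} (hΔ : 3 ≤ Δ) (α : ℝ) : IsAlpha Δ α ↔ IsTilt Δ 0 α := by
  have key : ∀ x : ℝ, 0 < x →
      (x * gammaPoly (Δ - 1) x / gammaPoly Δ x = 1 ↔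
        x * gammaPoly (Δ - 1) x + 0 * x * gammaPoly Δ x = gammaPoly Δ x) := fun x hx => by
    rw [div_eq_one_iff_eq (gammaPoly_pos (by omega) hx.le).ne', zero_mul, zero_mul, add_zero]
  constructor
  · rintro ⟨h1, h⟩
    exact ⟨by linarith, (key α (by linarith)).1 h⟩
  · intro h
    refine ⟨?_, (key α h.1).2 h.2⟩
    -- At `x = 1` the two sides of the equation compare strictly, so the root exceeds one.
    by_contra! hle
    have hmono := (strictMonoOn_saddle hΔ le_rfl).monotoneOn h.1.le
      (Set.mem_Ici.2 zero_le_one) hle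
    have h2 := ((isTilt_iff (by omega) 0 α).1 h).2
    have hlt : gammaPoly (Δ - 1) 1 < gammaPoly Δ 1 := by
      obtain ⟨d, rfl⟩ : ∃ d, Δ = d + 1 := ⟨Δ - 1, by omega⟩
      rw [Nat.add_sub_cancel]
      unfold gammaPoly
      rw [Finset.sum_range_succ]
      have : (0 : ℝ) < 1 ^ d / (d.factorial : ℝ) := by positivity
      linarith
    have h3 := gammaPoly_sub_mul_gammaPoly_pred (show 1 ≤ Δ by omega) 1
    simp only [zero_mul, add_zero] at hmono h2
    linarith

end Saddle

/-! ### Estimates for characteristic functions -/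

section CharFun

open Complex

/-- The terms of the weights `p 0` and `p 1` alone force decay of the characteristic function of
a distribution on the natural numbers. -/
lemma norm_sum_mul_exp_le {Δ : ℕ} (hΔ : 2 ≤ Δ) {p : ℕ → ℝ} (hp : ∀ k, 0 ≤ p k)
    (hp0 : 0 < p 0) (hsum : ∑ k ∈ Finset.range Δ, p k = 1) (t : ℝ) :
    ‖∑ k ∈ Finset.range Δ, (p k : ℂ) * exp (t * k * I)‖ ≤
      Real.exp (-(p 0 * p 1 * (1 - Real.cos t))) := by
  obtain ⟨d, rfl⟩ : ∃ d, Δ = 2 + d := ⟨Δ - 2, by omega⟩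
  rw [Finset.sum_range_add] at hsum ⊢
  simp only [Finset.sum_range_succ, Finset.sum_range_zero, zero_add] at hsum ⊢
  set x := p 0
  set y := p 1
  have hy : 0 ≤ y := hp 1
  set s := ∑ k ∈ Finset.range d, p (2 + k) with hs
  have hs0 : 0 ≤ s := Finset.sum_nonneg fun k _ => hp _
  have htail : ‖∑ k ∈ Finset.range d, (p (2 + k) : ℂ) * exp (t * (2 + k : ℕ) * I)‖ ≤ s := by
    refine (norm_sum_le _ _).trans (Finset.sum_le_sum fun k _ => ?_)
    have : (t : ℂ) * (2 + k : ℕ) * I = ((t * (2 + k : ℕ) : ℝ) : ℂ) * I := by push_cast; ring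
    rw [norm_mul, this, norm_exp_ofReal_mul_I, mul_one, Complex.norm_real, Real.norm_eq_abs,
      abs_of_nonneg (hp _)]
  set c := Real.cos t with hc
  have hc1 : c ≤ 1 := Real.cos_le_one t
  have hc2 : -1 ≤ c := Real.neg_one_le_cos t
  have hhead : ‖(x : ℂ) * exp (t * (0 : ℕ) * I) + (y : ℂ) * exp (t * (1 : ℕ) * I)‖ ≤
      x + y - x * y * (1 - c) := by
    have hexp : (x : ℂ) * exp (t * (0 : ℕ) * I) + (y : ℂ) * exp (t * (1 : ℕ) * I) =
        ((x + y * Real.cos t : ℝ) : ℂ) + ((y * Real.sin t : ℝ) : ℂ) * I := by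
      simp [exp_mul_I]
      ring
    have hxy : x + y ≤ 1 := by linarith
    have hxyc : x * y * (1 - c) ≤ x + y := by
      have h1 : x * y * (1 - c) ≤ x * y * 2 := by gcongr; linarith
      have h2 : (x + y) * (x + y) ≤ (x + y) * 1 := by gcongr
      nlinarith [sq_nonneg (x - y)]
    rw [hexp, Complex.norm_add_mul_I]
    refine Real.sqrt_le_iff.2 ⟨by linarith, ?_⟩
    have hsin : Real.sin t ^ 2 = 1 - c ^ 2 := by rw [hc, Real.sin_sq]
    have : (x + y * Real.cos t) ^ 2 + (y * Real.sin t) ^ 2 =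
        (x + y) ^ 2 - 2 * (x * y * (1 - c)) := by
      rw [mul_pow, hsin, ← hc]; ring
    rw [this]
    have h0 : 0 ≤ x * y * (1 - c) := by
      have : 0 ≤ 1 - c := by linarith
      positivity
    nlinarith
  calc _ ≤ (x + y - x * y * (1 - c)) + s := (norm_add_le _ _).trans (add_le_add hhead htail)
    _ = -(x * y * (1 - c)) + 1 := by linarith
    _ ≤ _ := Real.add_one_le_exp _

lemma norm_exp_mul_I_sub_le (y : ℝ) :
    ‖exp (y * I) - (1 + y * I - y ^ 2 / 2)‖ ≤ |y| ^ 3 * Real.exp |y| := by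
  have h := norm_exp_sub_sum_le_norm_mul_exp (y * I) 3
  simp only [Finset.sum_range_succ, Finset.sum_range_zero, zero_add, norm_mul, norm_I, mul_one,
    Complex.norm_real, Real.norm_eq_abs] at h
  have he : (y * I : ℂ) ^ 0 / (Nat.factorial 0 : ℂ) + (y * I) ^ 1 / (Nat.factorial 1 : ℂ) +
      (y * I) ^ 2 / (Nat.factorial 2 : ℂ) = 1 + y * I - y ^ 2 / 2 := by
    simp [mul_pow, Nat.factorial]
    ring
  rwa [he] at h

lemma norm_one_sub_sub_exp_neg_le (x : ℝ) :
    ‖(1 - x : ℂ) - exp (-x)‖ ≤ |x| ^ 2 * Real.exp |x| := by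
  have h := norm_exp_sub_sum_le_norm_mul_exp (-x : ℂ) 2
  simp only [Finset.sum_range_succ, Finset.sum_range_zero, zero_add, norm_neg,
    Complex.norm_real, Real.norm_eq_abs] at h
  have he : (-x : ℂ) ^ 0 / (Nat.factorial 0 : ℂ) + (-x) ^ 1 / (Nat.factorial 1 : ℂ) = 1 - x := by
    simp [Nat.factorial]
    ring
  rwa [he, norm_sub_rev] at h

/-- Second-order expansion of the characteristic function of a centred, bounded distribution. -/
lemma norm_sum_mul_exp_sub_exp_le {ι : Type*} (s : Finset ι) {p y : ι → ℝ}
    (hp : ∀ k ∈ s, 0 ≤ p k) (hsum : ∑ k ∈ s, p k = 1) (hmean : ∑ k ∈ s, p k * y k = 0)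
    {M : ℝ} (hM : ∀ k ∈ s, |y k| ≤ M) {t : ℝ} (ht : |t| ≤ 1) :
    ‖∑ k ∈ s, (p k : ℂ) * exp ((t * y k : ℝ) * I) -
      exp (-(((∑ k ∈ s, p k * y k ^ 2) * t ^ 2 / 2 : ℝ) : ℂ))‖ ≤
      (M ^ 3 * Real.exp M + M ^ 4 * Real.exp (M ^ 2)) * |t| ^ 3 := by
  set v := ∑ k ∈ s, p k * y k ^ 2 with hv
  have hne : s.Nonempty := by
    rw [Finset.nonempty_iff_ne_empty]
    rintro rfl
    simp at hsum
  obtain ⟨k₀, hk₀⟩ := hne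
  have hM0 : 0 ≤ M := (abs_nonneg _).trans (hM k₀ hk₀)
  have hv0 : 0 ≤ v := Finset.sum_nonneg fun k hk => mul_nonneg (hp k hk) (sq_nonneg _)
  have hvM : v ≤ M ^ 2 := by
    calc v ≤ ∑ k ∈ s, p k * M ^ 2 := Finset.sum_le_sum fun k hk =>
          mul_le_mul_of_nonneg_left (sq_le_sq.2 ((hM k hk).trans (le_abs_self M))) (hp k hk)
      _ = M ^ 2 := by rw [← Finset.sum_mul, hsum, one_mul]
  have hexpand : ((1 - v * t ^ 2 / 2 : ℝ) : ℂ) = ∑ k ∈ s, (p k : ℂ) *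
      (1 + (t * y k : ℝ) * I - (t * y k : ℝ) ^ 2 / 2) := by
    have h1 : (∑ k ∈ s, (p k : ℂ)) = 1 := by exact_mod_cast hsum
    have h2 : (∑ k ∈ s, (p k : ℂ) * y k) = 0 := by exact_mod_cast hmean
    have h3 : (∑ k ∈ s, (p k : ℂ) * y k ^ 2) = v := by rw [hv]; push_cast; rfl
    have : ∀ k ∈ s, (p k : ℂ) * (1 + (t * y k : ℝ) * I - (t * y k : ℝ) ^ 2 / 2) =
        p k + (p k * y k) * (t * I) - (p k * y k ^ 2) * (t ^ 2 / 2) := fun k _ => by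
      push_cast; ring
    rw [Finset.sum_congr rfl this, Finset.sum_sub_distrib, Finset.sum_add_distrib,
      ← Finset.sum_mul, ← Finset.sum_mul, h1, h2, h3]
    push_cast
    ring
  have hA : ‖∑ k ∈ s, (p k : ℂ) * exp ((t * y k : ℝ) * I) - ((1 - v * t ^ 2 / 2 : ℝ) : ℂ)‖ ≤
      M ^ 3 * Real.exp M * |t| ^ 3 := by
    rw [hexpand, ← Finset.sum_sub_distrib]
    calc _ ≤ ∑ k ∈ s, p k * (M ^ 3 * Real.exp M * |t| ^ 3) := by
          refine (norm_sum_le _ _).trans (Finset.sum_le_sum fun k hk => ?_)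
          rw [← mul_sub, norm_mul, Complex.norm_real, Real.norm_eq_abs, abs_of_nonneg (hp k hk)]
          refine mul_le_mul_of_nonneg_left ((norm_exp_mul_I_sub_le _).trans ?_) (hp k hk)
          have h1 : |t * y k| ≤ |t| * M := by
            rw [abs_mul]; exact mul_le_mul_of_nonneg_left (hM k hk) (abs_nonneg t)
          have h2 : |t * y k| ≤ M := h1.trans (mul_le_of_le_one_left hM0 ht)
          calc |t * y k| ^ 3 * Real.exp |t * y k| ≤ (|t| * M) ^ 3 * Real.exp M := by gcongr
            _ = _ := by ring
      _ = _ := by rw [← Finset.sum_mul, hsum, one_mul]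
  have hB : ‖((1 - v * t ^ 2 / 2 : ℝ) : ℂ) - exp (-((v * t ^ 2 / 2 : ℝ) : ℂ))‖ ≤
      M ^ 4 * Real.exp (M ^ 2) * |t| ^ 3 := by
    have h := norm_one_sub_sub_exp_neg_le (v * t ^ 2 / 2)
    have ht2 : t ^ 2 ≤ 1 := (sq_le_one_iff_abs_le_one t).2 ht
    have hx0 : 0 ≤ v * t ^ 2 / 2 := by positivity
    have hx1 : v * t ^ 2 / 2 ≤ M ^ 2 * |t| ^ 2 := by
      rw [sq_abs]
      have : v * t ^ 2 ≤ M ^ 2 * t ^ 2 := by gcongr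
      nlinarith [sq_nonneg t, sq_nonneg (M * t)]
    have hx2 : v * t ^ 2 / 2 ≤ M ^ 2 :=
      hx1.trans (mul_le_of_le_one_right (sq_nonneg M) (by rwa [sq_abs]))
    rw [abs_of_nonneg hx0] at h
    have hcast : ((1 - v * t ^ 2 / 2 : ℝ) : ℂ) = 1 - ((v * t ^ 2 / 2 : ℝ) : ℂ) := by push_cast; ring
    rw [hcast]
    refine h.trans ?_
    calc (v * t ^ 2 / 2) ^ 2 * Real.exp (v * t ^ 2 / 2)
        ≤ (M ^ 2 * |t| ^ 2) ^ 2 * Real.exp (M ^ 2) := by gcongr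
      _ = M ^ 4 * Real.exp (M ^ 2) * |t| ^ 3 * |t| := by ring
      _ ≤ M ^ 4 * Real.exp (M ^ 2) * |t| ^ 3 := mul_le_of_le_one_right (by positivity) ht
  calc _ ≤ _ := norm_sub_le_norm_sub_add_norm_sub _ ((1 - v * t ^ 2 / 2 : ℝ) : ℂ) _
    _ ≤ _ := add_le_add hA hB
    _ = _ := by ring

lemma norm_exp_sub_exp_le {a b : ℂ} (ha : a.re ≤ 0) (hb : b.re ≤ 0) :
    ‖exp a - exp b‖ ≤ ‖a - b‖ := by
  have h := (convex_halfSpace_re_le 0).norm_image_sub_le_of_norm_deriv_le (𝕜 := ℂ) (f := exp)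
    (C := 1) (x := b) (y := a) (fun x _ => Complex.differentiableAt_exp) (fun x hx => ?_) hb ha
  · simpa using h
  · rw [Complex.deriv_exp, Complex.norm_exp]
    exact Real.exp_le_one_iff.2 hx

lemma norm_pow_sub_pow_le_mul {a b : ℂ} (ha : ‖a‖ ≤ 1) (hb : ‖b‖ ≤ 1) (n : ℕ) :
    ‖a ^ n - b ^ n‖ ≤ n * ‖a - b‖ := by
  induction n with
  | zero => simp
  | succ n ih =>
    have : a ^ (n + 1) - b ^ (n + 1) = a ^ n * (a - b) + (a ^ n - b ^ n) * b := by ring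
    rw [this]
    calc _ ≤ ‖a ^ n * (a - b)‖ + ‖(a ^ n - b ^ n) * b‖ := norm_add_le _ _
      _ ≤ 1 * ‖a - b‖ + n * ‖a - b‖ * 1 := by
          rw [norm_mul, norm_mul, norm_pow]
          gcongr
          exact pow_le_one₀ (norm_nonneg a) ha
      _ = _ := by push_cast; ring

end CharFun

/-! ### A uniform local limit estimate -/

section LocalLimit

open Complex MeasureTheory Topology

lemma sqrt_mul_intervalIntegral_eq {f : ℝ → ℂ} {n : ℕ} (hn : 1 ≤ n) :
    (Real.sqrt n : ℂ) * ∫ t in (-Real.pi)..Real.pi, f t =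
      ∫ u, Set.indicator (Set.Ioc (-(Real.pi * Real.sqrt n)) (Real.pi * Real.sqrt n))
        (fun u => f (u / Real.sqrt n)) u := by
  have hs : 0 < Real.sqrt n := Real.sqrt_pos.2 (by exact_mod_cast hn)
  have h := intervalIntegral.integral_comp_div (a := -(Real.pi * Real.sqrt n))
    (b := Real.pi * Real.sqrt n) f hs.ne'
  rw [neg_div, mul_div_cancel_right₀ _ hs.ne'] at h
  rw [integral_indicator measurableSet_Ioc, ← intervalIntegral.integral_of_le, h,
    Complex.real_smul]
  have := mul_nonneg Real.pi_pos.le hs.le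
  linarith

lemma integral_exp_neg_mul_sq_div_two (b : ℝ) :
    ∫ u : ℝ, exp (-((b * u ^ 2 / 2 : ℝ) : ℂ)) = (Real.sqrt (2 * Real.pi / b) : ℂ) := by
  have h := integral_gaussian (b / 2)
  have h2 : Real.pi / (b / 2) = 2 * Real.pi / b := by
    rw [div_div_eq_mul_div, mul_comm]
  rw [h2] at h
  rw [← h, ← integral_complex_ofReal]
  congr 1
  funext u
  rw [Complex.ofReal_exp, ← Complex.ofReal_neg]
  congr 2
  ring

/-- A local limit estimate that is uniform in the underlying distributions: the functions `φ n`
play the role of characteristic functions of centred integer-valued variables with variances `β n`.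
The number `k` is the (bounded) offset between the mean and the point under consideration. -/
theorem tendsto_sqrt_mul_integral_pow_sub {φ : ℕ → ℝ → ℂ} {β : ℕ → ℝ} {κ b C : ℝ} (k : ℕ)
    (hκ : 0 < κ) (hb : 0 < b) (hcont : ∀ n, Continuous (φ n))
    (hβ : ∀ n, 1 ≤ n → b ≤ β n)
    (hdecay : ∀ n, 1 ≤ n → ∀ t, |t| ≤ Real.pi → ‖φ n t‖ ≤ Real.exp (-(κ * t ^ 2)))
    (htaylor : ∀ n, 1 ≤ n → ∀ t, |t| ≤ 1 →
      ‖φ n t - exp (-((β n * t ^ 2 / 2 : ℝ) : ℂ))‖ ≤ C * |t| ^ 3) :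
    Tendsto (fun n : ℕ => (Real.sqrt n : ℂ) *
        (∫ t in (-Real.pi)..Real.pi, φ n t ^ n * exp (k * t * I)) -
          (Real.sqrt (2 * Real.pi / β n) : ℂ)) atTop (𝓝 0) := by
  let F : ℕ → ℝ → ℂ := fun n u =>
    Set.indicator (Set.Ioc (-(Real.pi * Real.sqrt n)) (Real.pi * Real.sqrt n))
      (fun u => φ n (u / Real.sqrt n) ^ n * exp (k * (u / Real.sqrt n : ℝ) * I)) u
  let G : ℕ → ℝ → ℂ := fun n u => exp (-((β n * u ^ 2 / 2 : ℝ) : ℂ))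
  have hFmeas : ∀ n, AEStronglyMeasurable (F n) volume := fun n => by
    refine (Continuous.aestronglyMeasurable ?_).indicator measurableSet_Ioc
    have := hcont n
    fun_prop
  have hGcont : ∀ n, Continuous (G n) := fun n => by fun_prop
  have hGnorm : ∀ n u, ‖G n u‖ = Real.exp (-(β n * u ^ 2 / 2)) := fun n u => by
    simp only [G]
    rw [← Complex.ofReal_neg, Complex.norm_exp_ofReal]
  have hFbound : ∀ n, 1 ≤ n → ∀ u, ‖F n u‖ ≤ Real.exp (-κ * u ^ 2) := by
    intro n hn u
    have hn' : (0 : ℝ) < n := by exact_mod_cast hn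
    have hs : 0 < Real.sqrt n := Real.sqrt_pos.2 hn'
    by_cases hu : u ∈ Set.Ioc (-(Real.pi * Real.sqrt n)) (Real.pi * Real.sqrt n)
    · have habs : |u / Real.sqrt n| ≤ Real.pi := by
        rw [abs_div, abs_of_pos hs, div_le_iff₀ hs, abs_le]
        exact ⟨hu.1.le, hu.2⟩
      have he : (k : ℂ) * (u / Real.sqrt n : ℝ) * I = ((k * (u / Real.sqrt n) : ℝ) : ℂ) * I := by
        push_cast; ring
      simp only [F, Set.indicator_of_mem hu]
      rw [he, norm_mul, norm_exp_ofReal_mul_I, mul_one, norm_pow]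
      calc _ ≤ Real.exp (-(κ * (u / Real.sqrt n) ^ 2)) ^ n :=
            pow_le_pow_left₀ (norm_nonneg _) (hdecay n hn _ habs) n
        _ = Real.exp (-κ * u ^ 2) := by
            rw [← Real.exp_nat_mul, div_pow, Real.sq_sqrt hn'.le]
            congr 1
            field_simp
    · simp only [F, Set.indicator_of_notMem hu, norm_zero]
      exact (Real.exp_pos _).le
  have hGbound : ∀ n, 1 ≤ n → ∀ u, ‖G n u‖ ≤ Real.exp (-(b / 2) * u ^ 2) := by
    intro n hn u
    rw [hGnorm]
    refine Real.exp_le_exp.2 ?_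
    have := mul_le_mul_of_nonneg_right (hβ n hn) (sq_nonneg u)
    linarith
  have hint1 : Integrable fun u : ℝ => Real.exp (-κ * u ^ 2) := integrable_exp_neg_mul_sq hκ
  have hint2 : Integrable fun u : ℝ => Real.exp (-(b / 2) * u ^ 2) :=
    integrable_exp_neg_mul_sq (by positivity)
  have hFint : ∀ n, 1 ≤ n → Integrable (F n) := fun n hn =>
    hint1.mono' (hFmeas n) (ae_of_all _ (hFbound n hn))
  have hGint : ∀ n, 1 ≤ n → Integrable (G n) := fun n hn =>
    hint2.mono' (hGcont n).aestronglyMeasurable (ae_of_all _ (hGbound n hn))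
  have hsqrt : Tendsto (fun n : ℕ => Real.sqrt n) atTop atTop :=
    Real.tendsto_sqrt_atTop.comp tendsto_natCast_atTop_atTop
  have hlim : ∀ u, Tendsto (fun n => F n u - G n u) atTop (𝓝 0) := by
    intro u
    have hdiv : Tendsto (fun n : ℕ => u / Real.sqrt n) atTop (𝓝 0) :=
      hsqrt.const_div_atTop u
    have hphase : Tendsto (fun n : ℕ => ‖exp (k * (u / Real.sqrt n : ℝ) * I) - 1‖) atTop (𝓝 0) := by
      have hc : Continuous fun x : ℝ => ‖exp (k * (x : ℂ) * I) - 1‖ := by fun_prop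
      have := (hc.tendsto 0).comp hdiv
      simpa [Function.comp_def] using this
    have hsmall : Tendsto (fun n : ℕ => C * |u| ^ 3 / Real.sqrt n) atTop (𝓝 0) :=
      hsqrt.const_div_atTop _
    refine squeeze_zero_norm' ?_ (by simpa only [add_zero] using hphase.add hsmall)
    filter_upwards [eventually_ge_atTop 1, hsqrt.eventually_ge_atTop (|u| + 1)] with n hn hnu
    have hn' : (0 : ℝ) < n := by exact_mod_cast hn
    have hs : 0 < Real.sqrt n := Real.sqrt_pos.2 hn'
    have ht1 : |u / Real.sqrt n| ≤ 1 := by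
      rw [abs_div, abs_of_pos hs, div_le_one hs]
      linarith
    have hu : u ∈ Set.Ioc (-(Real.pi * Real.sqrt n)) (Real.pi * Real.sqrt n) := by
      have h1 : 1 * Real.sqrt n ≤ Real.pi * Real.sqrt n := by
        gcongr
        linarith [Real.pi_gt_three]
      have := abs_le.1 (show |u| ≤ |u| from le_rfl)
      constructor <;> linarith
    set t := u / Real.sqrt n with ht
    have hφ1 : ‖φ n t‖ ≤ 1 :=
      (hdecay n hn t (ht1.trans (by linarith [Real.pi_gt_three]))).trans
        (Real.exp_le_one_iff.2 (by have := mul_nonneg hκ.le (sq_nonneg t); linarith))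
    have hβ0 : 0 ≤ β n := hb.le.trans (hβ n hn)
    have hg1 : ‖exp (-((β n * t ^ 2 / 2 : ℝ) : ℂ))‖ ≤ 1 := by
      rw [← Complex.ofReal_neg, Complex.norm_exp_ofReal, Real.exp_le_one_iff]
      have := mul_nonneg hβ0 (sq_nonneg t)
      linarith
    have hGpow : G n u = exp (-((β n * t ^ 2 / 2 : ℝ) : ℂ)) ^ n := by
      simp only [G]
      rw [← Complex.exp_nat_mul]
      congr 1
      have : β n * u ^ 2 / 2 = n * (β n * t ^ 2 / 2) := by
        rw [ht, div_pow, Real.sq_sqrt hn'.le]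
        field_simp
      rw [this]
      push_cast
      ring
    have hFu : F n u = φ n t ^ n * exp (k * (t : ℝ) * I) := by
      simp only [F, Set.indicator_of_mem hu, ← ht]
    rw [hFu, hGpow]
    have hsplit : φ n t ^ n * exp (k * (t : ℝ) * I) - exp (-((β n * t ^ 2 / 2 : ℝ) : ℂ)) ^ n =
        φ n t ^ n * (exp (k * (t : ℝ) * I) - 1) +
          (φ n t ^ n - exp (-((β n * t ^ 2 / 2 : ℝ) : ℂ)) ^ n) := by ring
    rw [hsplit]
    refine (norm_add_le _ _).trans (add_le_add ?_ ?_)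
    · rw [norm_mul, norm_pow]
      exact mul_le_of_le_one_left (norm_nonneg _) (pow_le_one₀ (norm_nonneg _) hφ1)
    · refine (norm_pow_sub_pow_le_mul hφ1 hg1 n).trans ?_
      calc (n : ℝ) * ‖φ n t - exp (-((β n * t ^ 2 / 2 : ℝ) : ℂ))‖ ≤ n * (C * |t| ^ 3) := by
            gcongr
            exact htaylor n hn t ht1
        _ = C * |u| ^ 3 / Real.sqrt n := by
            rw [ht, abs_div, abs_of_pos hs]
            have : (n : ℝ) = Real.sqrt n ^ 2 := (Real.sq_sqrt hn'.le).symm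
            rw [this, Real.sqrt_sq hs.le]
            field_simp
  have hmain : Tendsto (fun n => ∫ u, (F n u - G n u)) atTop (𝓝 (∫ _ : ℝ, (0 : ℂ))) := by
    refine tendsto_integral_filter_of_dominated_convergence
      (fun u => Real.exp (-κ * u ^ 2) + Real.exp (-(b / 2) * u ^ 2)) ?_ ?_ (hint1.add hint2)
      (ae_of_all _ hlim)
    · exact Eventually.of_forall fun n => (hFmeas n).sub (hGcont n).aestronglyMeasurable
    · filter_upwards [eventually_ge_atTop 1] with n hn
      exact ae_of_all _ fun u =>
        (norm_sub_le _ _).trans (add_le_add (hFbound n hn u) (hGbound n hn u))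
  rw [integral_zero] at hmain
  refine hmain.congr' ?_
  filter_upwards [eventually_ge_atTop 1] with n hn
  rw [integral_sub (hFint n hn) (hGint n hn), integral_exp_neg_mul_sq_div_two,
    sqrt_mul_intervalIntegral_eq hn]

end LocalLimit

/-! ### The Fourier integral of the tilted generating function -/

section Fourier

open Complex MeasureTheory Topology

/-- The coefficient of `x ^ N` in `γ_Δ(x) ^ n * exp (w * x)`. -/
noncomputable def gammaExpCoeff (Δ n N : ℕ) (w : ℝ) : ℝ :=
  ∑ j ∈ Finset.range (N + 1), w ^ j / j.factorial * gammaPowCoeff Δ n (N - j)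

/-- The probability of `k` under the distribution on `{0, …, Δ - 1}` proportional to
`r ^ k / k!`. -/
noncomputable def tiltWeight (Δ : ℕ) (r : ℝ) (k : ℕ) : ℝ :=
  r ^ k / (k.factorial : ℝ) / gammaPoly Δ r

/-- The characteristic function of the distribution `tiltWeight Δ r`. -/
noncomputable def tiltCharFun (Δ : ℕ) (r t : ℝ) : ℂ :=
  ∑ k ∈ Finset.range Δ, (tiltWeight Δ r k : ℂ) * exp (t * k * I)

lemma continuous_tiltCharFun (Δ : ℕ) (r : ℝ) : Continuous (tiltCharFun Δ r) := by
  unfold tiltCharFun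
  fun_prop

lemma integral_exp_int_mul_I (m : ℤ) :
    ∫ t in (-Real.pi)..Real.pi, exp (t * m * I) = if m = 0 then (2 * Real.pi : ℂ) else 0 := by
  split_ifs with h
  · simp [h]
    ring
  · have hm : (m : ℂ) * I ≠ 0 := mul_ne_zero (Int.cast_ne_zero.2 h) I_ne_zero
    have h1 : ∀ t : ℝ, exp (t * m * I) = exp ((m * I) * t) := fun t => by congr 1; ring
    simp_rw [h1]
    rw [integral_exp_mul_complex hm, div_eq_zero_iff, sub_eq_zero]
    left
    rw [Complex.exp_eq_exp_iff_exists_int]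
    refine ⟨m, ?_⟩
    push_cast
    ring

/-- Fourier coefficients of `exp (s * e ^ (it))`. -/
lemma integral_exp_mul_exp (s : ℝ) (a N : ℕ) :
    ∫ t in (-Real.pi)..Real.pi, exp (s * exp (t * I)) * exp (t * ((a : ℤ) - N : ℤ) * I) =
      2 * Real.pi * if a ≤ N then (s : ℂ) ^ (N - a) / ((N - a).factorial : ℂ) else 0 := by
  let f : ℕ → C(ℝ, ℂ) := fun j =>
    ⟨fun t => (s : ℂ) ^ j / (j.factorial : ℂ) * exp (t * ((j : ℤ) + a - N : ℤ) * I), by fun_prop⟩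
  have hnorm : ∀ j t, ‖f j t‖ = |s| ^ j / j.factorial := by
    intro j t
    have : (t : ℂ) * ((j : ℤ) + a - N : ℤ) * I = ((t * ((j : ℤ) + a - N : ℤ) : ℝ) : ℂ) * I := by
      push_cast; ring
    simp only [f, ContinuousMap.coe_mk]
    rw [this, norm_mul, norm_exp_ofReal_mul_I, mul_one, norm_div, norm_pow, Complex.norm_real,
      Complex.norm_natCast, Real.norm_eq_abs]
  have hsum : ∀ t : ℝ, HasSum (fun j => f j t)
      (exp (s * exp (t * I)) * exp (t * ((a : ℤ) - N : ℤ) * I)) := by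
    intro t
    have h := (NormedSpace.expSeries_div_hasSum_exp (s * exp (t * I) : ℂ)).mul_right
      (exp (t * ((a : ℤ) - N : ℤ) * I))
    rw [← Complex.exp_eq_exp_ℂ] at h
    refine (congrArg (fun g => HasSum g _) (funext fun j => ?_)).mpr h
    simp only [f, ContinuousMap.coe_mk]
    have he : exp (t * ((j : ℤ) + a - N : ℤ) * I) =
        exp (t * I) ^ j * exp (t * ((a : ℤ) - N : ℤ) * I) := by
      rw [← Complex.exp_nat_mul, ← Complex.exp_add]
      congr 1
      push_cast
      ring
    rw [he, mul_pow]
    ring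
  have hint := intervalIntegral.hasSum_integral_of_dominated_convergence (μ := volume)
    (a := -Real.pi) (b := Real.pi) (F := fun j t => f j t) (fun j _ => |s| ^ j / j.factorial)
    (fun j => (f j).continuous.aestronglyMeasurable)
    (fun j => ae_of_all _ fun t _ => (hnorm j t).le)
    (ae_of_all _ fun t _ => Real.summable_pow_div_factorial |s|)
    (by simp)
    (ae_of_all _ fun t _ => hsum t)
  have hterm : ∀ j, ∫ t in (-Real.pi)..Real.pi, f j t =
      (s : ℂ) ^ j / (j.factorial : ℂ) * if j + a = N then (2 * Real.pi : ℂ) else 0 := by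
    intro j
    simp only [f, ContinuousMap.coe_mk]
    rw [intervalIntegral.integral_const_mul, integral_exp_int_mul_I]
    congr 1
    have : ((j : ℤ) + a - N = 0) ↔ (j + a = N) := by omega
    simp only [this]
  rw [← hint.tsum_eq]
  simp_rw [hterm]
  split_ifs with h
  · rw [tsum_eq_single (N - a)]
    · rw [if_pos (by omega)]
      ring
    · intro j hj
      rw [if_neg (by omega), mul_zero]
  · rw [mul_zero]
    convert tsum_zero with j
    rw [if_neg (by omega), mul_zero]

lemma gammaExpCoeff_mul_pow (Δ n N : ℕ) (w r : ℝ) :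
    gammaExpCoeff Δ n N w * r ^ N = ∑ e ∈ Fintype.piFinset (fun _ : Fin n => Finset.range Δ),
      r ^ (∑ v, e v) * (∏ v, ((e v).factorial : ℝ)⁻¹) *
        if ∑ v, e v ≤ N then (r * w) ^ (N - ∑ v, e v) / ((N - ∑ v, e v).factorial : ℝ) else 0 := by
  unfold gammaExpCoeff gammaPowCoeff
  simp_rw [Finset.sum_filter, Finset.mul_sum]
  rw [Finset.sum_comm, Finset.sum_mul]
  refine Finset.sum_congr rfl fun e _ => ?_
  set d := ∑ v, e v
  split_ifs with h
  · rw [Finset.sum_eq_single (N - d)]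
    · have hd : N - (N - d) = d := by omega
      have hr : r ^ N = r ^ d * r ^ (N - d) := by rw [← pow_add]; congr 1; omega
      rw [hd, if_pos rfl, hr, mul_pow]
      ring
    · intro j hj hne
      rw [Finset.mem_range] at hj
      rw [if_neg (by omega), mul_zero]
    · intro hne
      exact absurd (Finset.mem_range.2 (by omega)) hne
  · rw [mul_zero, Finset.sum_eq_zero, zero_mul]
    intro j hj
    rw [if_neg (by omega), mul_zero]

/-- Cauchy's formula on the circle of radius `r` for the coefficients of `γ_Δ(x) ^ n exp (w x)`,
normalised by the value of this function at `r`. -/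
lemma integral_tiltCharFun_pow {Δ : ℕ} {r : ℝ} (n N : ℕ) (w : ℝ) :
    ∫ t in (-Real.pi)..Real.pi, tiltCharFun Δ r t ^ n *
        exp (((r * w : ℝ) : ℂ) * (exp (t * I) - 1)) * exp (-(t * N * I)) =
      ((2 * Real.pi * (gammaExpCoeff Δ n N w * r ^ N /
        (gammaPoly Δ r ^ n * Real.exp (r * w))) : ℝ) : ℂ) := by
  set s := r * w with hs
  have hpow : ∀ t : ℝ, tiltCharFun Δ r t ^ n =
      ∑ e ∈ Fintype.piFinset (fun _ : Fin n => Finset.range Δ),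
        (∏ v, (tiltWeight Δ r (e v) : ℂ)) * exp (t * (∑ v, e v : ℕ) * I) := by
    intro t
    have : tiltCharFun Δ r t ^ n = ∏ _v : Fin n, tiltCharFun Δ r t := by simp
    rw [this]
    unfold tiltCharFun
    rw [Finset.prod_univ_sum]
    refine Finset.sum_congr rfl fun e _ => ?_
    rw [Finset.prod_mul_distrib, ← Complex.exp_sum]
    congr 2
    push_cast
    rw [Finset.mul_sum, Finset.sum_mul]
  have hintegrand : ∀ t : ℝ, tiltCharFun Δ r t ^ n * exp ((s : ℂ) * (exp (t * I) - 1)) *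
      exp (-(t * N * I)) =
      ∑ e ∈ Fintype.piFinset (fun _ : Fin n => Finset.range Δ),
        ((∏ v, (tiltWeight Δ r (e v) : ℂ)) * exp (-s)) * (exp (s * exp (t * I)) *
          exp (t * (((∑ v, e v : ℕ) : ℤ) - N : ℤ) * I)) := by
    intro t
    rw [hpow, Finset.sum_mul, Finset.sum_mul]
    refine Finset.sum_congr rfl fun e _ => ?_
    have h1 : exp ((s : ℂ) * (exp (t * I) - 1)) = exp (-s) * exp (s * exp (t * I)) := by
      rw [← Complex.exp_add]; congr 1; ring
    have h2 : exp (t * (((∑ v, e v : ℕ) : ℤ) - N : ℤ) * I) =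
        exp (t * (∑ v, e v : ℕ) * I) * exp (-(t * N * I)) := by
      rw [← Complex.exp_add]; congr 1; push_cast; ring
    rw [h1, h2]
    ring
  simp_rw [hintegrand]
  rw [intervalIntegral.integral_finsetSum fun e _ => (Continuous.intervalIntegrable
    (by fun_prop) _ _)]
  simp_rw [intervalIntegral.integral_const_mul, integral_exp_mul_exp]
  have hterm : ∀ e : Fin n → ℕ, (∏ v, (tiltWeight Δ r (e v) : ℂ)) * exp (-s) *
      (2 * Real.pi * if ∑ v, e v ≤ N then
        (s : ℂ) ^ (N - ∑ v, e v) / ((N - ∑ v, e v).factorial : ℂ) else 0) =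
      ((2 * Real.pi * (r ^ (∑ v, e v) * (∏ v, ((e v).factorial : ℝ)⁻¹) *
        (if ∑ v, e v ≤ N then s ^ (N - ∑ v, e v) / ((N - ∑ v, e v).factorial : ℝ) else 0) /
        (gammaPoly Δ r ^ n * Real.exp s)) : ℝ) : ℂ) := by
    intro e
    have hprod : ∏ v, tiltWeight Δ r (e v) =
        r ^ (∑ v, e v) * (∏ v, ((e v).factorial : ℝ)⁻¹) / gammaPoly Δ r ^ n := by
      simp only [tiltWeight, div_eq_mul_inv, Finset.prod_mul_distrib, Finset.prod_pow_eq_pow_sum,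
        Finset.prod_const, Finset.card_univ, Fintype.card_fin, inv_pow]
    rw [← Complex.ofReal_prod, hprod, ← Complex.ofReal_neg, ← Complex.ofReal_exp, Real.exp_neg]
    split_ifs
    · push_cast
      ring
    · simp
  simp_rw [hterm]
  rw [← Complex.ofReal_sum, ← Finset.mul_sum, ← Finset.sum_div, gammaExpCoeff_mul_pow]

end Fourier

/-! ### Asymptotics of the coefficients -/

section Asymptotics

open Complex MeasureTheory Topology

lemma IsTilt.mul_le_one {Δ : ℕ} (hΔ : 1 ≤ Δ) {c r : ℝ} (h : IsTilt Δ c r) : r * c ≤ 1 := by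
  obtain ⟨hr, h⟩ := h
  have hγ := gammaPoly_pos hΔ hr.le
  have h1 : 0 ≤ gammaPoly (Δ - 1) r := Finset.sum_nonneg fun k _ => by positivity
  have h2 : (r * c) * gammaPoly Δ r ≤ 1 * gammaPoly Δ r := by
    have := mul_nonneg hr.le h1
    linarith
  exact le_of_mul_le_mul_right h2 hγ

lemma tiltWeight_nonneg {Δ : ℕ} (hΔ : 1 ≤ Δ) {r : ℝ} (hr : 0 ≤ r) (k : ℕ) :
    0 ≤ tiltWeight Δ r k :=
  div_nonneg (by positivity) (gammaPoly_pos hΔ hr).le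

lemma sum_tiltWeight {Δ : ℕ} (hΔ : 1 ≤ Δ) {r : ℝ} (hr : 0 ≤ r) :
    ∑ k ∈ Finset.range Δ, tiltWeight Δ r k = 1 := by
  unfold tiltWeight
  rw [← Finset.sum_div, ← gammaPoly, div_self (gammaPoly_pos hΔ hr).ne']

lemma sum_tiltWeight_mul {Δ : ℕ} (hΔ : 1 ≤ Δ) {c r : ℝ} (h : IsTilt Δ c r) :
    ∑ k ∈ Finset.range Δ, tiltWeight Δ r k * k = 1 - r * c := by
  have hγ := gammaPoly_pos hΔ h.1.le
  have h1 : ∑ k ∈ Finset.range Δ, tiltWeight Δ r k * k = r * gammaPoly (Δ - 1) r / gammaPoly Δ r := by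
    rw [mul_gammaPoly_pred, Finset.sum_div]
    refine Finset.sum_congr rfl fun k _ => ?_
    rw [tiltWeight]
    ring
  rw [h1, div_eq_iff hγ.ne']
  have := h.2
  linarith

lemma sum_tiltWeight_mul_sq {Δ : ℕ} (hΔ : 1 ≤ Δ) {c r : ℝ} (h : IsTilt Δ c r) :
    ∑ k ∈ Finset.range Δ, tiltWeight Δ r k * k ^ 2 =
      r ^ 2 * gammaPoly (Δ - 2) r / gammaPoly Δ r + (1 - r * c) := by
  rw [← sum_tiltWeight_mul hΔ h, sq_mul_gammaPoly_pred_pred, Finset.sum_div,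
    ← Finset.sum_add_distrib]
  refine Finset.sum_congr rfl fun k _ => ?_
  rw [tiltWeight]
  ring

/-- The variance of the sum of a variable with distribution `tiltWeight Δ r` and an independent
Poisson variable with parameter `r * c`, when `r` solves the saddle-point equation. -/
noncomputable def tiltVariance (Δ : ℕ) (c r : ℝ) : ℝ :=
  r ^ 2 * gammaPoly (Δ - 2) r / gammaPoly Δ r + 2 * (r * c) - (r * c) ^ 2

lemma tiltVariance_ge {Δ : ℕ} (hΔ : 3 ≤ Δ) {c r : ℝ} (hc0 : 0 ≤ c) (hc1 : c ≤ 1)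
    (h : IsTilt Δ c r) : 1 / 4 * Real.exp (-2) ≤ tiltVariance Δ c r := by
  have hr := h.1
  have h1 := h.half_le hΔ hc1
  have h2 := h.le_two hΔ hc0
  have hs := h.mul_le_one (by omega)
  have hs0 : 0 ≤ r * c := mul_nonneg hr.le hc0
  have hγ := gammaPoly_pos (show 1 ≤ Δ by omega) hr.le
  have hle : gammaPoly Δ r ≤ Real.exp 2 :=
    (gammaPoly_le_exp Δ hr.le).trans (Real.exp_le_exp.2 h2)
  have h3 : 1 / 4 * Real.exp (-2) ≤ r ^ 2 * gammaPoly (Δ - 2) r / gammaPoly Δ r := by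
    rw [Real.exp_neg, ← div_eq_mul_inv]
    have h4 : 1 ≤ gammaPoly (Δ - 2) r := one_le_gammaPoly (by omega) hr.le
    have h5 : 1 / 4 ≤ r ^ 2 := by nlinarith
    have h6 : 1 / 4 ≤ r ^ 2 * gammaPoly (Δ - 2) r := by nlinarith
    gcongr
  unfold tiltVariance
  nlinarith

lemma tiltVariance_le {Δ : ℕ} (hΔ : 3 ≤ Δ) {c r : ℝ} (hc0 : 0 ≤ c)
    (h : IsTilt Δ c r) : tiltVariance Δ c r ≤ 6 := by
  have hr := h.1
  have h2 := h.le_two hΔ hc0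
  have hs := h.mul_le_one (by omega)
  have hγ := gammaPoly_pos (show 1 ≤ Δ by omega) hr.le
  have h3 : r ^ 2 * gammaPoly (Δ - 2) r / gammaPoly Δ r ≤ r ^ 2 := by
    rw [div_le_iff₀ hγ]
    exact mul_le_mul_of_nonneg_left (gammaPoly_mono (Nat.sub_le Δ 2) hr.le) (sq_nonneg r)
  unfold tiltVariance
  nlinarith [sq_nonneg (r * c)]

/-- The characteristic function of the centred variable behind the saddle-point method: a variable
with distribution `tiltWeight Δ r`, plus an independent Poisson variable with parameter `r * c`,
minus one. -/
noncomputable def saddleCharFun (Δ : ℕ) (c r t : ℝ) : ℂ :=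
  tiltCharFun Δ r t * exp (((r * c : ℝ) : ℂ) * (exp (t * I) - 1)) * exp (-(t * I))

lemma continuous_saddleCharFun (Δ : ℕ) (c r : ℝ) : Continuous (saddleCharFun Δ c r) := by
  have := continuous_tiltCharFun Δ r
  unfold saddleCharFun
  fun_prop

lemma re_mul_exp_sub_one (s t : ℝ) : ((s : ℂ) * (exp (t * I) - 1)).re = -(s * (1 - Real.cos t)) := by
  rw [Complex.re_ofReal_mul, Complex.sub_re, Complex.exp_ofReal_mul_I_re, Complex.one_re]
  ring

lemma norm_tiltCharFun_le {Δ : ℕ} (hΔ : 2 ≤ Δ) {r : ℝ} (hr : 0 < r) (t : ℝ) :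
    ‖tiltCharFun Δ r t‖ ≤ Real.exp (-(r / gammaPoly Δ r ^ 2 * (1 - Real.cos t))) := by
  have hγ := gammaPoly_pos (show 1 ≤ Δ by omega) hr.le
  have h := norm_sum_mul_exp_le hΔ (p := tiltWeight Δ r)
    (tiltWeight_nonneg (by omega) hr.le) (by simp [tiltWeight, hγ])
    (sum_tiltWeight (by omega) hr.le) t
  refine h.trans_eq ?_
  congr 3
  simp [tiltWeight]
  field_simp

lemma norm_tiltCharFun_le_one {Δ : ℕ} (hΔ : 2 ≤ Δ) {r : ℝ} (hr : 0 < r) (t : ℝ) :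
    ‖tiltCharFun Δ r t‖ ≤ 1 := by
  refine (norm_tiltCharFun_le hΔ hr t).trans (Real.exp_le_one_iff.2 ?_)
  have h1 : 0 ≤ 1 - Real.cos t := by linarith [Real.cos_le_one t]
  have : 0 ≤ r / gammaPoly Δ r ^ 2 * (1 - Real.cos t) := by positivity
  linarith

lemma norm_saddleCharFun_le {Δ : ℕ} (hΔ : 3 ≤ Δ) {c r : ℝ} (hc0 : 0 ≤ c) (hc1 : c ≤ 1)
    (h : IsTilt Δ c r) {t : ℝ} (ht : |t| ≤ Real.pi) :
    ‖saddleCharFun Δ c r t‖ ≤ Real.exp (-(Real.exp (-4) / Real.pi ^ 2 * t ^ 2)) := by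
  have hr := h.1
  have hγ := gammaPoly_pos (show 1 ≤ Δ by omega) hr.le
  have hcos : 2 / Real.pi ^ 2 * t ^ 2 ≤ 1 - Real.cos t := by
    linarith [Real.cos_le_one_sub_mul_cos_sq ht]
  have hcos0 : 0 ≤ 1 - Real.cos t := by linarith [Real.cos_le_one t]
  have hcoef : Real.exp (-4) / 2 ≤ r / gammaPoly Δ r ^ 2 := by
    have h1 := h.half_le hΔ hc1
    have h2 : gammaPoly Δ r ≤ Real.exp 2 :=
      (gammaPoly_le_exp Δ hr.le).trans (Real.exp_le_exp.2 (h.le_two hΔ hc0))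
    have h3 : gammaPoly Δ r ^ 2 ≤ Real.exp 4 := by
      calc gammaPoly Δ r ^ 2 ≤ Real.exp 2 ^ 2 := by gcongr
        _ = Real.exp 4 := by rw [← Real.exp_nat_mul]; norm_num
    calc Real.exp (-4) / 2 = 1 / 2 / Real.exp 4 := by rw [Real.exp_neg]; ring
      _ ≤ _ := by gcongr
  have hpoisson : ‖exp (((r * c : ℝ) : ℂ) * (exp (t * I) - 1))‖ ≤ 1 := by
    rw [Complex.norm_exp, re_mul_exp_sub_one, Real.exp_le_one_iff]
    have : 0 ≤ r * c * (1 - Real.cos t) := mul_nonneg (mul_nonneg hr.le hc0) hcos0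
    linarith
  have hphase : ‖exp (-(t * I))‖ = 1 := by
    rw [← neg_mul, ← Complex.ofReal_neg, norm_exp_ofReal_mul_I]
  rw [saddleCharFun, norm_mul, norm_mul, hphase, mul_one]
  calc _ ≤ Real.exp (-(r / gammaPoly Δ r ^ 2 * (1 - Real.cos t))) * 1 :=
        mul_le_mul (norm_tiltCharFun_le (by omega) hr t) hpoisson (norm_nonneg _)
          (Real.exp_pos _).le
    _ ≤ _ := by
      rw [mul_one, Real.exp_le_exp, neg_le_neg_iff]
      calc Real.exp (-4) / Real.pi ^ 2 * t ^ 2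
          = Real.exp (-4) / 2 * (2 / Real.pi ^ 2 * t ^ 2) := by ring
        _ ≤ _ := by gcongr

lemma norm_saddleCharFun_sub_le {Δ : ℕ} (hΔ : 3 ≤ Δ) {c r : ℝ} (hc0 : 0 ≤ c)
    (h : IsTilt Δ c r) {t : ℝ} (ht : |t| ≤ 1) :
    ‖saddleCharFun Δ c r t - exp (-((tiltVariance Δ c r * t ^ 2 / 2 : ℝ) : ℂ))‖ ≤
      ((Δ : ℝ) ^ 3 * Real.exp Δ + (Δ : ℝ) ^ 4 * Real.exp ((Δ : ℝ) ^ 2) + Real.exp 1) *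
        |t| ^ 3 := by
  have hr := h.1
  have hΔ1 : 1 ≤ Δ := by omega
  set s := r * c with hs
  have hs0 : 0 ≤ s := mul_nonneg hr.le hc0
  have hs1 : s ≤ 1 := h.mul_le_one hΔ1
  have hsum := sum_tiltWeight hΔ1 hr.le
  have hmul := sum_tiltWeight_mul hΔ1 h
  have hsq := sum_tiltWeight_mul_sq hΔ1 h
  rw [← hs] at hmul hsq
  -- The two independent parts are centred separately, at `1 - s` and at `s`.
  set v := ∑ k ∈ Finset.range Δ, tiltWeight Δ r k * (k - (1 - s)) ^ 2 with hv
  have hvar : tiltVariance Δ c r = v + s := by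
    have hexp : v = ∑ k ∈ Finset.range Δ, tiltWeight Δ r k * k ^ 2 -
        2 * (1 - s) * ∑ k ∈ Finset.range Δ, tiltWeight Δ r k * k +
        (1 - s) ^ 2 * ∑ k ∈ Finset.range Δ, tiltWeight Δ r k := by
      rw [hv, Finset.mul_sum, Finset.mul_sum, ← Finset.sum_sub_distrib, ← Finset.sum_add_distrib]
      refine Finset.sum_congr rfl fun k _ => ?_
      ring
    rw [hexp, hsum, hmul, hsq, tiltVariance, ← hs]
    ring
  have hv0 : 0 ≤ v := Finset.sum_nonneg fun k _ =>
    mul_nonneg (tiltWeight_nonneg hΔ1 hr.le k) (sq_nonneg _)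
  have hmean : ∑ k ∈ Finset.range Δ, tiltWeight Δ r k * (k - (1 - s)) = 0 := by
    simp_rw [fun k : ℕ => mul_sub (tiltWeight Δ r k) k (1 - s)]
    rw [Finset.sum_sub_distrib, ← Finset.sum_mul, hsum, hmul]
    ring
  have hM : ∀ k ∈ Finset.range Δ, |(k : ℝ) - (1 - s)| ≤ Δ := by
    intro k hk
    have hk' : (k : ℝ) + 1 ≤ Δ := by exact_mod_cast Finset.mem_range.1 hk
    have hk0 : (0 : ℝ) ≤ k := k.cast_nonneg
    rw [abs_le]
    constructor <;> linarith
  have hA := norm_sum_mul_exp_sub_exp_le (Finset.range Δ)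
    (fun k _ => tiltWeight_nonneg hΔ1 hr.le k) hsum hmean hM ht
  rw [← hv] at hA
  set A := ∑ k ∈ Finset.range Δ, (tiltWeight Δ r k : ℂ) * exp ((t * (k - (1 - s)) : ℝ) * I)
    with hAdef
  have hAeq : A = tiltCharFun Δ r t * exp (-((t * (1 - s) : ℝ) * I)) := by
    rw [hAdef, tiltCharFun, Finset.sum_mul]
    refine Finset.sum_congr rfl fun k _ => ?_
    rw [mul_assoc, ← Complex.exp_add]
    congr 2
    push_cast
    ring
  have hA1 : ‖A‖ ≤ 1 := by
    rw [hAeq, norm_mul, ← neg_mul, ← Complex.ofReal_neg, norm_exp_ofReal_mul_I, mul_one]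
    exact norm_tiltCharFun_le_one (by omega) hr t
  let a : ℂ := (s : ℂ) * (exp (t * I) - 1 - t * I)
  let b : ℂ := -((s * t ^ 2 / 2 : ℝ) : ℂ)
  have hb : b.re ≤ 0 := by
    simp only [b]
    rw [← Complex.ofReal_neg, Complex.ofReal_re]
    have : 0 ≤ s * t ^ 2 / 2 := by positivity
    linarith
  have ha : a.re ≤ 0 := by
    have h1 : a = (s : ℂ) * (exp (t * I) - 1) - ((s * t : ℝ) : ℂ) * I := by
      simp only [a]; push_cast; ring
    rw [h1, Complex.sub_re, re_mul_exp_sub_one, Complex.re_ofReal_mul, Complex.I_re, mul_zero,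
      sub_zero]
    have : 0 ≤ s * (1 - Real.cos t) := mul_nonneg hs0 (by linarith [Real.cos_le_one t])
    linarith
  have hB : ‖exp a - exp b‖ ≤ Real.exp 1 * |t| ^ 3 := by
    refine (norm_exp_sub_exp_le ha hb).trans ?_
    have h1 : a - b = (s : ℂ) * (exp (t * I) - (1 + t * I - t ^ 2 / 2)) := by
      simp only [a, b]; push_cast; ring
    rw [h1, norm_mul, Complex.norm_real, Real.norm_eq_abs, abs_of_nonneg hs0]
    calc _ ≤ 1 * (|t| ^ 3 * Real.exp |t|) := by
          gcongr
          exact norm_exp_mul_I_sub_le t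
      _ ≤ 1 * (|t| ^ 3 * Real.exp 1) := by gcongr
      _ = _ := by ring
  have hb1 : ‖exp b‖ ≤ 1 := by
    rw [Complex.norm_exp]; exact Real.exp_le_one_iff.2 hb
  have hφ : saddleCharFun Δ c r t = A * exp a := by
    rw [saddleCharFun, hAeq, ← hs, mul_assoc, mul_assoc, ← Complex.exp_add, ← Complex.exp_add]
    congr 2
    simp only [a]
    push_cast
    ring
  have hg : exp (-((tiltVariance Δ c r * t ^ 2 / 2 : ℝ) : ℂ)) =
      exp (-((v * t ^ 2 / 2 : ℝ) : ℂ)) * exp b := by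
    rw [← Complex.exp_add, hvar]
    congr 1
    simp only [b]
    push_cast
    ring
  rw [hφ, hg]
  have hsplit : A * exp a - exp (-((v * t ^ 2 / 2 : ℝ) : ℂ)) * exp b =
      A * (exp a - exp b) + (A - exp (-((v * t ^ 2 / 2 : ℝ) : ℂ))) * exp b := by ring
  rw [hsplit]
  calc _ ≤ ‖A * (exp a - exp b)‖ + ‖(A - exp (-((v * t ^ 2 / 2 : ℝ) : ℂ))) * exp b‖ :=
        norm_add_le _ _
    _ ≤ 1 * (Real.exp 1 * |t| ^ 3) +
        (((Δ : ℝ) ^ 3 * Real.exp Δ + (Δ : ℝ) ^ 4 * Real.exp ((Δ : ℝ) ^ 2)) * |t| ^ 3) * 1 := by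
      rw [norm_mul, norm_mul]
      gcongr
    _ = _ := by ring

/-- Saddle-point asymptotics for the coefficient of `x ^ (n - k)` in `γ_Δ(x) ^ n exp (c n x)`,
uniformly for `c` in `[0, 1]`. -/
theorem tendsto_gammaExpCoeff {Δ : ℕ} (hΔ : 3 ≤ Δ) {c r : ℕ → ℝ} (k : ℕ)
    (hc0 : ∀ n, 1 ≤ n → 0 ≤ c n) (hc1 : ∀ n, 1 ≤ n → c n ≤ 1)
    (hr : ∀ n, 1 ≤ n → IsTilt Δ (c n) (r n)) :
    Tendsto (fun n : ℕ => gammaExpCoeff Δ n (n - k) (c n * n) * r n ^ (n - k) /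
      (gammaPoly Δ (r n) ^ n * Real.exp (r n * (c n * n))) *
        Real.sqrt (2 * Real.pi * tiltVariance Δ (c n) (r n) * n)) atTop (𝓝 1) := by
  set X : ℕ → ℝ := fun n => gammaExpCoeff Δ n (n - k) (c n * n) * r n ^ (n - k) /
      (gammaPoly Δ (r n) ^ n * Real.exp (r n * (c n * n))) with hX
  set β : ℕ → ℝ := fun n => tiltVariance Δ (c n) (r n) with hβ
  have hβge : ∀ n, 1 ≤ n → 1 / 4 * Real.exp (-2) ≤ β n := fun n hn =>
    tiltVariance_ge hΔ (hc0 n hn) (hc1 n hn) (hr n hn)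
  have hlim := tendsto_sqrt_mul_integral_pow_sub k
    (φ := fun n => saddleCharFun Δ (c n) (r n)) (β := β)
    (κ := Real.exp (-4) / Real.pi ^ 2) (b := 1 / 4 * Real.exp (-2))
    (by positivity) (by positivity) (fun n => continuous_saddleCharFun Δ (c n) (r n)) hβge
    (fun n hn t ht => norm_saddleCharFun_le hΔ (hc0 n hn) (hc1 n hn) (hr n hn) ht)
    (fun n hn t ht => norm_saddleCharFun_sub_le hΔ (hc0 n hn) (hr n hn) ht)
  have hint : ∀ n, k ≤ n → ∫ t in (-Real.pi)..Real.pi,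
      saddleCharFun Δ (c n) (r n) t ^ n * exp (k * t * I) = ((2 * Real.pi * X n : ℝ) : ℂ) := by
    intro n hn
    rw [hX, ← integral_tiltCharFun_pow]
    congr 1
    funext t
    rw [saddleCharFun, mul_pow, mul_pow, mul_assoc, ← Complex.exp_nat_mul, ← Complex.exp_nat_mul,
      ← Complex.exp_add]
    congr 3
    · push_cast
      ring
    · push_cast [Nat.cast_sub hn]
      ring
  have hreal : Tendsto (fun n : ℕ => Real.sqrt n * (2 * Real.pi * X n) -
      Real.sqrt (2 * Real.pi / β n)) atTop (𝓝 0) := by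
    have h0 : Tendsto (fun n : ℕ => ((Real.sqrt n * (2 * Real.pi * X n) -
        Real.sqrt (2 * Real.pi / β n) : ℝ) : ℂ)) atTop (𝓝 ((0 : ℝ) : ℂ)) := by
      rw [Complex.ofReal_zero]
      refine hlim.congr' ?_
      filter_upwards [eventually_ge_atTop k] with n hn
      rw [hint n hn]
      push_cast
      ring
    exact tendsto_ofReal_iff.1 h0
  have hzero : Tendsto (fun n : ℕ => Real.sqrt (β n / (2 * Real.pi)) *
      (Real.sqrt n * (2 * Real.pi * X n) - Real.sqrt (2 * Real.pi / β n))) atTop (𝓝 0) := by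
    refine squeeze_zero_norm' (a := fun n : ℕ => Real.sqrt (6 / (2 * Real.pi)) *
      ‖Real.sqrt n * (2 * Real.pi * X n) - Real.sqrt (2 * Real.pi / β n)‖) ?_ ?_
    · filter_upwards [eventually_ge_atTop 1] with n hn
      rw [norm_mul, Real.norm_of_nonneg (Real.sqrt_nonneg _)]
      have := tiltVariance_le hΔ (hc0 n hn) (hr n hn)
      gcongr
    · simpa using hreal.norm.const_mul (Real.sqrt (6 / (2 * Real.pi)))
  have hone := hzero.add_const 1
  rw [zero_add] at hone
  refine hone.congr' ?_
  filter_upwards [eventually_ge_atTop 1] with n hn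
  have hβ0 : 0 < β n := lt_of_lt_of_le (by positivity) (hβge n hn)
  have h1 : Real.sqrt (β n / (2 * Real.pi)) * Real.sqrt (2 * Real.pi / β n) = 1 := by
    rw [← Real.sqrt_mul (by positivity)]
    have : β n / (2 * Real.pi) * (2 * Real.pi / β n) = 1 := by field_simp
    rw [this, Real.sqrt_one]
  have h2 : Real.sqrt (β n / (2 * Real.pi)) * Real.sqrt n * (2 * Real.pi) =
      Real.sqrt (2 * Real.pi * β n * n) := by
    have hsq : (2 * Real.pi : ℝ) = Real.sqrt ((2 * Real.pi) ^ 2) :=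
      (Real.sqrt_sq (by positivity)).symm
    rw [← Real.sqrt_mul (by positivity)]
    nth_rewrite 2 [hsq]
    rw [← Real.sqrt_mul (by positivity)]
    congr 1
    field_simp
  rw [mul_sub, h1, ← h2]
  ring

end Asymptotics

/-! ### Counting trees and forests asymptotically -/

section Main

open Topology

lemma betaFun_eq {Δ n : ℕ} {w r : ℝ} :
    betaFun Δ n w r = tiltVariance Δ (w / n) r := by
  unfold betaFun tiltVariance
  rw [deriv_gammaPoly, deriv_gammaPoly, Nat.sub_sub]
  ring

theorem isEquivalent_sum_rootedForestCount {Δ : ℕ} (hΔ : 3 ≤ Δ) {w r : ℕ → ℝ}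
    (hw : ∀ n : ℕ, 1 ≤ n → 0 < w n ∧ w n ≤ (n : ℝ))
    (hr : ∀ n : ℕ, 1 ≤ n → IsSaddlePoint Δ n (w n) (r n)) :
    (fun n : ℕ => ∑ m ∈ Finset.Icc 1 n, (rootedForestCount Δ n m : ℝ) * w n ^ m) ~[atTop]
      (fun n : ℕ => w n * (((n - 1).factorial : ℝ) / r n ^ (n - 1)) *
        (gammaPoly Δ (r n) ^ n * Real.exp (r n * w n) /
          Real.sqrt (2 * Real.pi * betaFun Δ n (w n) (r n) * n))) := by
  have hc0 : ∀ n : ℕ, 1 ≤ n → 0 ≤ w n / n := fun n hn =>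
    div_nonneg (hw n hn).1.le n.cast_nonneg
  have hc1 : ∀ n : ℕ, 1 ≤ n → w n / n ≤ 1 := fun n hn =>
    div_le_one_of_le₀ (hw n hn).2 n.cast_nonneg
  have htilt : ∀ n : ℕ, 1 ≤ n → IsTilt Δ (w n / n) (r n) := fun n hn =>
    (isSaddlePoint_iff (by omega) _ _).1 (hr n hn)
  refine isEquivalent_iff_exists_eq_mul.2
    ⟨_, tendsto_gammaExpCoeff hΔ (c := fun n => w n / n) 1 hc0 hc1 htilt, ?_⟩
  filter_upwards [eventually_ge_atTop 1] with n hn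
  have hn' : (0 : ℝ) < n := by exact_mod_cast hn
  have hr0 := (hr n hn).1
  have hγ := gammaPoly_pos (show 1 ≤ Δ by omega) hr0.le
  have hβ : 0 < tiltVariance Δ (w n / n) (r n) :=
    lt_of_lt_of_le (by positivity) (tiltVariance_ge hΔ (hc0 n hn) (hc1 n hn) (htilt n hn))
  have hS : 0 < Real.sqrt (2 * Real.pi * tiltVariance Δ (w n / n) (r n) * n) :=
    Real.sqrt_pos.2 (by positivity)
  simp only [Pi.mul_apply]
  rw [betaFun_eq, sum_rootedForestCount (by omega), div_mul_cancel₀ _ hn'.ne', gammaExpCoeff,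
    Nat.sub_add_cancel hn]
  field_simp

lemma gammaExpCoeff_zero (Δ n N : ℕ) : gammaExpCoeff Δ n N 0 = gammaPowCoeff Δ n N := by
  rw [gammaExpCoeff, Finset.sum_range_succ', Finset.sum_eq_zero]
  · simp
  · intro j _
    simp

theorem isEquivalent_treeCount {Δ : ℕ} (hΔ : 3 ≤ Δ) {α : ℝ} (hα : IsAlpha Δ α) :
    (fun n : ℕ => (treeCount Δ n : ℝ)) ~[atTop]
      (fun n : ℕ => α * Real.sqrt (gammaPoly Δ α / gammaPoly (Δ - 2) α) *
        (gammaPoly (Δ - 1) α / Real.exp 1) ^ n * (n : ℝ) ^ (n - 2)) := by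
  have htilt := (isAlpha_iff hΔ α).1 hα
  have hα0 := htilt.1
  have hγ := gammaPoly_pos (show 1 ≤ Δ by omega) hα0.le
  have hγ2 := gammaPoly_pos (show 1 ≤ Δ - 2 by omega) hα0.le
  have hγ1 : gammaPoly (Δ - 1) α = gammaPoly Δ α / α := by
    rw [eq_div_iff hα0.ne']
    linarith [htilt.2]
  obtain ⟨h₁, hh₁, hstir⟩ :=
    isEquivalent_iff_exists_eq_mul.1 Stirling.factorial_isEquivalent_stirling
  have hh₂ := tendsto_gammaExpCoeff hΔ (c := fun _ => 0) (r := fun _ => α) 2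
    (fun _ _ => le_rfl) (fun _ _ => zero_le_one) (fun _ _ => htilt)
  have hh₃ : Tendsto (fun n : ℕ => (n : ℝ) / ((n : ℝ) + (-1))) atTop (𝓝 1) :=
    tendsto_natCast_div_add_atTop (-1 : ℝ)
  have hh := (hh₁.mul hh₂).mul hh₃
  rw [mul_one, mul_one] at hh
  refine isEquivalent_iff_exists_eq_mul.2 ⟨_, hh, ?_⟩
  filter_upwards [eventually_ge_atTop 2, hstir] with n hn hfac
  obtain ⟨m, rfl⟩ : ∃ m, n = m + 2 := ⟨n - 2, by omega⟩
  have hvar : tiltVariance Δ 0 α = α ^ 2 * (gammaPoly (Δ - 2) α / gammaPoly Δ α) := by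
    unfold tiltVariance
    ring
  have hsqrt : Real.sqrt (2 * Real.pi * tiltVariance Δ 0 α * (m + 2 : ℕ)) *
      Real.sqrt (gammaPoly Δ α / gammaPoly (Δ - 2) α) =
      α * Real.sqrt (2 * (m + 2 : ℕ) * Real.pi) := by
    rw [hvar, ← Real.sqrt_mul (by positivity)]
    have : 2 * Real.pi * (α ^ 2 * (gammaPoly (Δ - 2) α / gammaPoly Δ α)) * (m + 2 : ℕ) *
        (gammaPoly Δ α / gammaPoly (Δ - 2) α) = α ^ 2 * (2 * (m + 2 : ℕ) * Real.pi) := by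
      field_simp
    rw [this, Real.sqrt_mul (sq_nonneg α), Real.sqrt_sq hα0.le]
  have hfac' : ((m + 2 : ℕ) : ℝ) * (((m + 2 : ℕ) : ℝ) + (-1)) * (m.factorial : ℝ) =
      h₁ (m + 2) * (Real.sqrt (2 * (m + 2 : ℕ) * Real.pi) *
        (((m + 2 : ℕ) : ℝ) / Real.exp 1) ^ (m + 2)) := by
    have hfac₂ : ((m + 2).factorial : ℝ) = h₁ (m + 2) * (Real.sqrt (2 * (m + 2 : ℕ) * Real.pi) *
        (((m + 2 : ℕ) : ℝ) / Real.exp 1) ^ (m + 2)) := hfac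
    rw [← hfac₂]
    push_cast [Nat.factorial_succ]
    ring
  simp only [Pi.mul_apply, Nat.add_sub_cancel, zero_mul, mul_zero, Real.exp_zero, mul_one]
  rw [treeCount_eq, gammaExpCoeff_zero, hγ1]
  have hM : (1 : ℝ) < (m + 2 : ℕ) := by exact_mod_cast (by omega : 1 < m + 2)
  generalize ((m + 2 : ℕ) : ℝ) = M at *
  have hM0 : M ≠ 0 := by linarith
  have hM1 : M + -1 ≠ 0 := by linarith
  have he : Real.exp 1 ≠ 0 := (Real.exp_pos 1).ne'
  set P := gammaPowCoeff Δ (m + 2) m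
  set S := Real.sqrt (2 * Real.pi * tiltVariance Δ 0 α * M)
  set Q := Real.sqrt (gammaPoly Δ α / gammaPoly (Δ - 2) α)
  set T := Real.sqrt (2 * M * Real.pi)
  calc (m.factorial : ℝ) * P = M * (M + -1) * m.factorial * P / (M * (M + -1)) := by field_simp
    _ = h₁ (m + 2) * (α * T) * P * M ^ (m + 1) / (Real.exp 1 ^ (m + 2) * α * (M + -1)) := by
      rw [hfac', div_pow, pow_succ M (m + 1)]
      field_simp
    _ = h₁ (m + 2) * (P * α ^ m / gammaPoly Δ α ^ (m + 2) * S) * (M / (M + -1)) *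
        (α * Q * (gammaPoly Δ α / α / Real.exp 1) ^ (m + 2) * M ^ m) := by
      rw [← hsqrt, div_pow, div_pow, pow_succ M m, pow_add α m 2]
      field_simp

end Main

theorem theorem3 (Δ : ℕ) (hΔ : 3 ≤ Δ) (w : ℕ → ℝ)
    (hw : ∀ n : ℕ, 1 ≤ n → 0 < w n ∧ w n ≤ (n : ℝ)) :
    ((∃! α : ℝ, IsAlpha Δ α) ∧
      ∀ α : ℝ, IsAlpha Δ α →
        (fun n : ℕ => (treeCount Δ n : ℝ)) ~[atTop]
          (fun n : ℕ => α * Real.sqrt (gammaPoly Δ α / gammaPoly (Δ - 2) α) *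
            (gammaPoly (Δ - 1) α / Real.exp 1) ^ n * (n : ℝ) ^ (n - 2))) ∧
    ((∀ n : ℕ, 1 ≤ n → ∃! r : ℝ, IsSaddlePoint Δ n (w n) r) ∧
      ∀ r : ℕ → ℝ, (∀ n : ℕ, 1 ≤ n → IsSaddlePoint Δ n (w n) (r n)) →
        (fun n : ℕ => ∑ m ∈ Finset.Icc 1 n, (rootedForestCount Δ n m : ℝ) * w n ^ m) ~[atTop]
          (fun n : ℕ => w n * (((n - 1).factorial : ℝ) / r n ^ (n - 1)) *
            (gammaPoly Δ (r n) ^ n * Real.exp (r n * w n) /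
              Real.sqrt (2 * Real.pi * betaFun Δ n (w n) (r n) * n)))) := by
  refine ⟨⟨?_, fun α hα => isEquivalent_treeCount hΔ hα⟩, fun n hn => ?_,
    fun r hr => isEquivalent_sum_rootedForestCount hΔ hw hr⟩
  · simp_rw [isAlpha_iff hΔ]
    exact existsUnique_isTilt hΔ le_rfl
  · simp_rw [isSaddlePoint_iff (show 1 ≤ Δ by omega)]
    exact existsUnique_isTilt hΔ (div_nonneg (hw n hn).1.le n.cast_nonneg)
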